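/- **Setting.** For $N\ge 1$ let $\Gamma(N)\subseteq SL_2(\mathbb Z)$ be the principal congruence subgroup. For even $K\ge 2$ put $G_K(z)=-\frac{B_K}{2K}+\sum_{n\ge1}\big(\sum_{d\mid n}d^{K-1}\big)e^{2\pi inz}$ on the upper half plane $\mathbb H$. Let $\mathcal M_w$ be the space of functions on $\mathbb H$ that are modular forms of weight $w\ge 0$ for some $\Gamma(N)$, $N\geq 1$. A *quasimodular form* of level $\Gamma(N)$, weight $k\ge0$ and depth $s\ge 0$ is a holomorphic $f:\mathbb H\to\mathbb C$ for which there are holomorphic $f_0,\dots,f_s$ on $\mathbb H$, $f_s\neq0$, holomorphic at the cusps (i.e. for every $j$ and every $\gamma=\begin{pmatrix}a&b\\c&d\end{pmatrix}\in SL_2(\mathbb Z)$ the function $(cz+d)^{-(k-2j)}f_j(\gamma z)$ is bounded as $\operatorname{Im}z\to\infty$), such that $$(cz+d)^{-k}f\Big(\frac{az+b}{cz+d}\Big)=\sum_{j=0}^s f_j(z)\Big(\frac{c}{cz+d}\Big)^j\qquad\text{for all }\begin{pmatrix}a&b\\c&d\end{pmatrix}\in\Gamma(N);$$ the zero function is quasimodular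 of every weight and of depth $0$. Let $\mathcal{QM}$ be the space of all finite sums of quasimodular forms (of all weights, depths and levels $\Gamma(N)$, $N\ge1$). By the structure theorem of Kaneko and Zagier every $f\in\mathcal{QM}$ can be written in exactly one way as a finite sum $f=\sum_{i,w\ge 0}a_{i,w}G_2^i$ with $a_{i,w}\in\mathcal M_w$; put $a_i(f)=\sum_w a_{i,w}$. For $\alpha=\begin{pmatrix}a&b\\c&d\end{pmatrix}\in GL_2^+(\mathbb Q)$ let $(g|_w\alpha)(z)=(cz+d)^{-w}g\big(\frac{az+b}{cz+d}\big)$ and $f\|\alpha=\sum_{i,w}(a_{i,w}|_w\alpha)\,G_2^i$. Let $\Gamma=\Gamma(N)$. The space $\mathcal Q(\Gamma)$ of quasimodular Hecke operators of level $\Gamma$ consists of the functions of finite support $F:\Gamma\backslash GL_2^+(\mathbb Q)\to\mathcal{QM}$, $\Gamma\alpha\mapsto F_\alpha$, with $F_{\alpha\gamma}=F_\alpha\|\gamma$ for all $\alpha\in GL_2^+(\mathbb Q)$, $\gamma\in\Gamma$. On $\mathcal{QM}$ define, for $k\ge1$ and $l\ge0$, $$D(f)=-\frac1{8\pi i}\sum_i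 i\,a_i(f)\,G_2^{i-1}G_2',\qquad T_k^l(f)=G_4^l\sum_i i\,a_i(f)\,G_2^{i+k-2},$$ and for $m\ge1$, $\alpha\in GL_2^+(\mathbb Q)$ put $\nu_\alpha^{(m)}=-\frac5{24}\big(G_4^m|_{4m}\alpha-G_4^m\big)$. **Theorem.** Let $\mathcal L$ be the complex Lie algebra generated by the symbols $D$, $T_k^l$ ($k\ge1$, $l\ge0$) and $\phi^{(m)}$ ($m\ge1$) subject to the relations $$[T_k^l,T_{k'}^{l'}]=(k'-k)T_{k+k'-2}^{l+l'},\qquad [D,\phi^{(m)}]=[T_k^l,\phi^{(m)}]=[\phi^{(m)},\phi^{(m')}]=0,$$ $$[T_k^l,D]=\tfrac5{24}(k-1)T_{k-1}^{l+1}-\tfrac12(k-3)T_{k+1}^l$$ (terms with coefficient $0$, in which $T_0^l$ may occur, are read as $0$). Then, for every $N\ge1$ and $\Gamma=\Gamma(N)$, the Lie algebra $\mathcal L$ acts on $\mathcal Q(\Gamma)$ through the operators above: there is a homomorphism of complex Lie algebras $\rho:\mathcal L\to\operatorname{End}_{\mathbb C}(\mathcal Q(\Gamma))$ with $$(\rho(D)F)_\alpha=D(F_\alpha),\qquad(\rho(T_k^l)F)_\alpha=T_k^l(F_\alpha),\qquad(\rho(\phi^{(m)})F)_\alpha=\nu_\alpha^{(m)}\cdot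 F_\alpha$$ for all $F\in\mathcal Q(\Gamma)$ and $\alpha\in GL_2^+(\mathbb Q)$. (In particular these formulas define operators on $\mathcal Q(\Gamma)$.) -/

import Mathlib

open UpperHalfPlane
open scoped MatrixGroups ModularForm Manifold

-- The ring of linear endomorphisms of a vector space is a Lie ring under the commutator.
attribute [local instance] LieRing.ofAssociativeRing

namespace QuasimodularHecke

noncomputable section

/-! ### Eisenstein series -/

/-- The Eisenstein series `G_K(z) = -B_K/(2K) + ∑_{n ≥ 1} σ_{K-1}(n) exp(2πinz)`
(used for even `K ≥ 2`). -/
def eisG (K : ℕ) (z : ℍ) : ℂ :=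
  -((bernoulli K : ℚ) : ℂ) / (2 * (K : ℂ)) +
    ∑' n : ℕ+, (ArithmeticFunction.sigma (K - 1) (n : ℕ) : ℂ) *
      Complex.exp (2 * (Real.pi : ℂ) * Complex.I * (n : ℂ) * (z : ℂ))

/-- The weight two Eisenstein series `G₂`. -/
def G2 : ℍ → ℂ := eisG 2

/-- The weight four Eisenstein series `G₄`. -/
def G4 : ℍ → ℂ := eisG 4

/-- The complex derivative `G₂'` of `G₂`. -/
def G2' (z : ℍ) : ℂ := deriv (G2 ∘ ofComplex) (z : ℂ)

/-! ### Modular and quasimodular forms -/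

/-- `Γ(N)` as a subgroup of `GL₂(ℝ)`. -/
abbrev levelR (N : ℕ) : Subgroup (GL (Fin 2) ℝ) :=
  (CongruenceSubgroup.Gamma N).map (Matrix.SpecialLinearGroup.mapGL ℝ)

/-- `f : ℍ → ℂ` is a modular form of weight `w` and level `Γ(N)`. -/
def IsModularForm (N w : ℕ) (f : ℍ → ℂ) : Prop :=
  ∃ g : ModularForm (levelR N) (w : ℤ), (g : ℍ → ℂ) = f

theorem levelR_mono {N N' : ℕ} (h : N ∣ N') : levelR N' ≤ levelR N := by
  apply Subgroup.map_mono
  intro γ hγ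
  rw [CongruenceSubgroup.Gamma_mem] at hγ ⊢
  have key : ∀ a b : ℤ, (a : ZMod N') = (b : ZMod N') → (a : ZMod N) = (b : ZMod N) := by
    intro a b hab
    rw [ZMod.intCast_eq_intCast_iff_dvd_sub] at hab ⊢
    exact (Int.natCast_dvd_natCast.mpr h).trans hab
  obtain ⟨h1, h2, h3, h4⟩ := hγ
  refine ⟨?_, ?_, ?_, ?_⟩
  · simpa using key _ 1 (by simpa using h1)
  · simpa using key _ 0 (by simpa using h2)
  · simpa using key _ 0 (by simpa using h3)
  · simpa using key _ 1 (by simpa using h4)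

theorem IsModularForm.mono {N N' w : ℕ} (h : N ∣ N') {f : ℍ → ℂ}
    (hf : IsModularForm N w f) : IsModularForm N' w f := by
  obtain ⟨g, rfl⟩ := hf
  exact ⟨{ toFun := g
           slash_action_eq' := fun γ hγ => g.slash_action_eq' γ (levelR_mono h hγ)
           holo' := g.holo'
           bdd_at_cusps' := fun hc => g.bdd_at_cusps' (hc.mono (levelR_mono h)) }, rfl⟩

/-- The weight `w` part of the modular tower: the functions that are modular forms of weight `w`
and of some level `Γ(N)`, `N ≥ 1`. -/
def modularTower (w : ℕ) : Submodule ℂ (ℍ → ℂ) where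
  carrier := {f | ∃ N : ℕ, 1 ≤ N ∧ IsModularForm N w f}
  zero_mem' := ⟨1, le_rfl, 0, rfl⟩
  add_mem' := by
    rintro f g ⟨N, hN, hf⟩ ⟨N', hN', hg⟩
    obtain ⟨f', rfl⟩ := hf.mono (Dvd.intro N' rfl)
    obtain ⟨g', rfl⟩ := hg.mono (Dvd.intro_left N rfl)
    exact ⟨N * N', Nat.mul_pos hN hN', f' + g', rfl⟩
  smul_mem' := by
    rintro c f ⟨N, hN, f', rfl⟩
    exact ⟨N, hN, c • f', rfl⟩

/-- `f` is a quasimodular form of level `Γ(N)`, weight `k` and depth `s`: a holomorphic function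
with holomorphic `f_0, …, f_s`, `f_s ≠ 0`, such that
`(cz+d)^{-k} f((az+b)/(cz+d)) = ∑_{j ≤ s} f_j(z) (c/(cz+d))^j` on `Γ(N)`.  As usual the `f_j`
are required to be holomorphic at the cusps, i.e. each `f_j |_{k-2j} γ`, `γ ∈ SL₂(ℤ)`, is bounded
as `Im z → ∞` (note `f = f_0`).  By convention the zero function has depth `0`. -/
def IsQuasimodularForm (N k s : ℕ) (f : ℍ → ℂ) : Prop :=
  (f = 0 ∧ s = 0) ∨
  (MDifferentiable 𝓘(ℂ) 𝓘(ℂ) f ∧ ∃ φ : ℕ → ℍ → ℂ,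
    (∀ j ≤ s, MDifferentiable 𝓘(ℂ) 𝓘(ℂ) (φ j)) ∧
    (∀ j ≤ s, ∀ γ : SL(2, ℤ), IsBoundedAtImInfty (φ j ∣[(k : ℤ) - 2 * (j : ℤ)] γ)) ∧
    φ s ≠ 0 ∧
    ∀ γ ∈ CongruenceSubgroup.Gamma N, ∀ z : ℍ,
      (((γ 1 0 : ℤ) : ℂ) * (z : ℂ) + ((γ 1 1 : ℤ) : ℂ)) ^ (-(k : ℤ)) * f (γ • z) =
        ∑ j ∈ Finset.range (s + 1),
          φ j z * (((γ 1 0 : ℤ) : ℂ) / (((γ 1 0 : ℤ) : ℂ) * (z : ℂ) + ((γ 1 1 : ℤ) : ℂ))) ^ j)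

/-- The quasimodular tower `QM`: sums of quasimodular forms of arbitrary weight, depth and level
`Γ(N)`, `N ≥ 1`. -/
def QM : Submodule ℂ (ℍ → ℂ) :=
  Submodule.span ℂ {f | ∃ N k s : ℕ, 1 ≤ N ∧ IsQuasimodularForm N k s f}

/-! ### The expansion of a quasimodular form in powers of `G₂` -/

/-- Families of modular coefficients `a_{i,w}`, almost all zero, with `a_{i,w}` of weight `w`. -/
abbrev Coeffs : Type := DirectSum (ℕ × ℕ) fun p => modularTower p.2

/-- `∑_{i,w} L_{i,w}(a_{i,w})`, for linear maps `L_{i,w}` on functions. -/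
def sumCoeffs (L : ℕ → ℕ → (ℍ → ℂ) →ₗ[ℂ] (ℍ → ℂ)) : Coeffs →ₗ[ℂ] (ℍ → ℂ) :=
  DirectSum.toModule ℂ (ℕ × ℕ) (ℍ → ℂ) fun p => L p.1 p.2 ∘ₗ (modularTower p.2).subtype

/-- `(a_{i,w}) ↦ ∑_{i,w} a_{i,w} G₂^i`. -/
def polyG2 : Coeffs →ₗ[ℂ] (ℍ → ℂ) :=
  sumCoeffs fun i _ => LinearMap.mulRight ℂ (G2 ^ i)

/-- The modular coefficients of `f = ∑_i a_i(f) G₂^i`, `a_i(f) = ∑_w a_{i,w}`.  By the structure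
theorem of Kaneko and Zagier every quasimodular form is such a polynomial in `G₂`, in exactly one
way: `polyG2` is injective with range `QM`, and `coeffs` restricted to `QM` is its inverse.
(It is applied to elements of `QM` only; linearity is built in.) -/
def coeffs : (ℍ → ℂ) →ₗ[ℂ] Coeffs :=
  LinearMap.leftInverse (K := ℂ) (V := Coeffs) (V' := ℍ → ℂ) polyG2

/-! ### Slash operators -/

/-- The group `GL₂⁺(ℚ)`. -/
abbrev GQ : Type := Matrix.GLPos (Fin 2) ℚ

/-- `α ∈ GL₂⁺(ℚ)` as a real matrix, acting on `ℍ` by Möbius transformations. -/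
def toReal (α : GQ) : GL (Fin 2) ℝ :=
  Matrix.GeneralLinearGroup.map (algebraMap ℚ ℝ) (α : GL (Fin 2) ℚ)

/-- `(f |_w α)(z) = (cz+d)^{-w} f((az+b)/(cz+d))` (no determinant factor). -/
def slash (w : ℕ) (α : GQ) : (ℍ → ℂ) →ₗ[ℂ] (ℍ → ℂ) where
  toFun f z := (denom (toReal α) z) ^ (-(w : ℤ)) * f (toReal α • z)
  map_add' f g := by ext z; simp [mul_add]
  map_smul' c f := by ext z; simp [mul_left_comm]

/-- `f || α = ∑_{i,w} (a_{i,w} |_w α) G₂^i` for `f = ∑_{i,w} a_{i,w} G₂^i` in `QM`. -/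
def dslash (α : GQ) : (ℍ → ℂ) →ₗ[ℂ] (ℍ → ℂ) :=
  sumCoeffs (fun i w => LinearMap.mulRight ℂ (G2 ^ i) ∘ₗ slash w α) ∘ₗ coeffs

/-! ### The operators on the quasimodular tower -/

/-- `D(f) = -(1/8πi) ∑_i i a_i(f) G₂^{i-1} G₂'`. -/
def opD : (ℍ → ℂ) →ₗ[ℂ] (ℍ → ℂ) :=
  (-(1 / (8 * (Real.pi : ℂ) * Complex.I))) •
    (sumCoeffs (fun i _ => (i : ℂ) • LinearMap.mulRight ℂ (G2 ^ (i - 1) * G2')) ∘ₗ coeffs)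

/-- `W_k(f) = ∑_i i a_i(f) G₂^{i+k-2}` for `k ≥ 1` (the term `i = 0` vanishes, and
`i + k - 2 ≥ 0` in all others). -/
def opW (k : ℕ) : (ℍ → ℂ) →ₗ[ℂ] (ℍ → ℂ) :=
  sumCoeffs (fun i _ => (i : ℂ) • LinearMap.mulRight ℂ (G2 ^ (i + k - 2))) ∘ₗ coeffs

/-- `T_k^l(f) = G₄^l W_k(f)`. -/
def opT (k l : ℕ) (f : ℍ → ℂ) : ℍ → ℂ := G4 ^ l * opW k f

/-- `ν_α^{(m)} = -(5/24) (G₄^m | α - G₄^m)`, where `G₄^m` has weight `4m`. -/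
def nu (m : ℕ) (α : GQ) : ℍ → ℂ :=
  (-(5 / 24) : ℂ) • (slash (4 * m) α (G4 ^ m) - G4 ^ m)

/-! ### Quasimodular Hecke operators -/

/-- The inclusion `SL₂(ℤ) → GL₂⁺(ℚ)`. -/
def toGQ : SL(2, ℤ) →* GQ :=
  Matrix.SpecialLinearGroup.toGLPos.comp (Matrix.SpecialLinearGroup.map (Int.castRingHom ℚ))

/-- `Γ(N)` as a subgroup of `GL₂⁺(ℚ)`. -/
def levelQ (N : ℕ) : Subgroup GQ := (CongruenceSubgroup.Gamma N).map toGQ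

/-- The space `Q(Γ(N))` of quasimodular Hecke operators of level `Γ(N)`: functions
`F : Γ \ GL₂⁺(ℚ) → QM`, given as left `Γ`-invariant functions on `GL₂⁺(ℚ)`, supported on finitely
many cosets `Γα`, with `F_{αγ} = F_α || γ` for `γ ∈ Γ`. -/
def HeckeOps (N : ℕ) : Submodule ℂ (GQ → ℍ → ℂ) where
  carrier := {F |
    (∀ α, F α ∈ QM) ∧
    (∀ γ ∈ levelQ N, ∀ α, F (γ * α) = F α) ∧
    ((Quotient.mk (QuotientGroup.rightRel (levelQ N))) '' {α | F α ≠ 0}).Finite ∧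
    (∀ γ ∈ levelQ N, ∀ α, F (α * γ) = dslash γ (F α))}
  zero_mem' := ⟨fun _ => QM.zero_mem, fun _ _ _ => rfl, by simp, fun _ _ _ => by simp⟩
  add_mem' := by
    rintro F G ⟨h1, h2, h3, h4⟩ ⟨k1, k2, k3, k4⟩
    refine ⟨fun α => QM.add_mem (h1 α) (k1 α), fun γ hγ α => ?_, ?_, fun γ hγ α => ?_⟩
    · simp only [Pi.add_apply, h2 γ hγ α, k2 γ hγ α]
    · refine (h3.union k3).subset ?_
      rw [← Set.image_union]
      refine Set.image_mono fun α hα => ?_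
      by_contra hcon
      simp only [Set.mem_union, Set.mem_ofPred_eq, not_or, not_not] at hcon
      exact hα (by simp [hcon.1, hcon.2])
    · simp only [Pi.add_apply, h4 γ hγ α, k4 γ hγ α, map_add]
  smul_mem' := by
    rintro c F ⟨h1, h2, h3, h4⟩
    refine ⟨fun α => QM.smul_mem c (h1 α), fun γ hγ α => ?_, ?_, fun γ hγ α => ?_⟩
    · simp only [Pi.smul_apply, h2 γ hγ α]
    · refine h3.subset (Set.image_mono fun α hα h0 => hα ?_)
      simp [h0]
    · simp only [Pi.smul_apply, h4 γ hγ α, map_smul]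

/-! ### The Lie algebra `L` -/

/-- The symbols `D`, `T_k^l` (`k ≥ 1`, `l ≥ 0`) and `φ^{(m)}` (`m ≥ 1`). -/
inductive Symbols : Type
  | D : Symbols
  | T : ℕ+ → ℕ → Symbols
  | phi : ℕ+ → Symbols

/-- The free complex Lie algebra on the symbols. -/
abbrev FreeL : Type := FreeLieAlgebra ℂ Symbols

/-- The symbol `D` in the free Lie algebra. -/
def freeD : FreeL := FreeLieAlgebra.of ℂ Symbols.D

/-- The symbol `T_k^l` in the free Lie algebra; `T_0^l`, which occurs in the relations
with coefficient `0` only, is read as `0`. -/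
def freeT (k l : ℕ) : FreeL :=
  if h : 0 < k then FreeLieAlgebra.of ℂ (Symbols.T ⟨k, h⟩ l) else 0

/-- The symbol `φ^{(m)}` in the free Lie algebra. -/
def freePhi (m : ℕ+) : FreeL := FreeLieAlgebra.of ℂ (Symbols.phi m)

/-- The defining relations of `L`, written as elements that have to vanish. -/
inductive IsRelator : FreeL → Prop
  | TT (k k' l l' : ℕ) (hk : 1 ≤ k) (hk' : 1 ≤ k') :
      IsRelator (⁅freeT k l, freeT k' l'⁆ - ((k' : ℂ) - (k : ℂ)) • freeT (k + k' - 2) (l + l'))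
  | Dphi (m : ℕ+) : IsRelator ⁅freeD, freePhi m⁆
  | Tphi (k l : ℕ) (m : ℕ+) (hk : 1 ≤ k) : IsRelator ⁅freeT k l, freePhi m⁆
  | phiphi (m m' : ℕ+) : IsRelator ⁅freePhi m, freePhi m'⁆
  | TD (k l : ℕ) (hk : 1 ≤ k) :
      IsRelator (⁅freeT k l, freeD⁆ - (((5 / 24 : ℂ) * ((k : ℂ) - 1)) • freeT (k - 1) (l + 1) -
        ((1 / 2 : ℂ) * ((k : ℂ) - 3)) • freeT (k + 1) l))

/-- The ideal generated by the relations. -/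
def relIdeal : LieIdeal ℂ FreeL := LieSubmodule.lieSpan ℂ FreeL {x | IsRelator x}

/-- The Lie algebra `L`: generated by the symbols `D`, `T_k^l`, `φ^{(m)}`, subject to the
relations. -/
abbrev LieL : Type := FreeL ⧸ relIdeal

/-- The generator of `L` attached to a symbol. -/
def gen (x : Symbols) : LieL := LieSubmodule.Quotient.mk (N := relIdeal) (FreeLieAlgebra.of ℂ x)

end

end QuasimodularHecke

namespace QuasimodularHecke

noncomputable section

/-! ### The Eisenstein series of weight two and four -/

/-! Every quasimodular form is, in exactly one way, a polynomial in `G2` over the ring of modular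
forms of all levels (`range_polyG2`, `ker_polyG2`). With X = `G2`, the operator T_k^l is then the
derivation G₄^l X^(k-1) d/dX over that ring, and the brackets of the T's are those of polynomial
vector fields on a line (`linT_comm`). Ramanujan's identity G₂' = 2πi(-2G₂² + (5/6)G₄) gives D =
(1/2)T_3^0 - (5/24)T_1^1 (`opD_eq`), so the relation for [T_k^l, D] is a special case. All these
derivations kill modular forms, hence commute with multiplication by ν_α^(m).

The operators preserve the space of Hecke operators because G₄ has level one: slashing by SL₂(ℤ)
fixes G₄^l (`dslash_linT`), and ν is left invariant and right equivariant (`nu_mul_left`,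
`nu_mul_right`). Since the relators act by zero, the action of the free Lie algebra descends to the
quotient.

Both halves of the structure theorem rest on one device: at a fixed point z the automorphy factors
of Γ(N) take infinitely many values, so transformation laws become polynomial identities whose
coefficients can be compared. Ramanujan's identity follows from the Serre derivative of E₂ lying in
the one-dimensional space of level one forms of weight four. -/

theorem G2_eq (z : ℍ) : G2 z = -(1 / 24) * EisensteinSeries.E2 z := by
  rw [EisensteinSeries.E2_eq_tsum_cexp]
  simp only [G2, eisG]
  have h : ∀ n : ℕ+, Complex.exp (2 * (Real.pi : ℂ) * Complex.I * (n : ℂ) * (z : ℂ)) =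
      Complex.exp (2 * (Real.pi : ℂ) * Complex.I * (z : ℂ)) ^ (n : ℕ) := by
    intro n
    rw [← Complex.exp_nat_mul]
    ring_nf
  simp only [h, show (2 - 1 : ℕ) = 1 from rfl]
  rw [show bernoulli 2 = 1 / 6 by rw [bernoulli_eq_bernoulli'_of_ne_one (by norm_num), bernoulli'_two]]
  push_cast
  ring

theorem G4_eq (z : ℍ) : G4 z = 1 / 240 * ModularForm.E₄ z := by
  rw [EisensteinSeries.q_expansion_bernoulli (by norm_num) ⟨2, rfl⟩]
  simp only [G4, eisG]
  have h : ∀ n : ℕ+, Complex.exp (2 * (Real.pi : ℂ) * Complex.I * (n : ℂ) * (z : ℂ)) =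
      Complex.exp (2 * (Real.pi : ℂ) * Complex.I * (z : ℂ)) ^ ((n : ℕ) : ℤ) := by
    intro n
    rw [zpow_natCast, ← Complex.exp_nat_mul]
    ring_nf
  simp only [h, show (4 - 1 : ℕ) = 3 from rfl]
  rw [show bernoulli 4 = -1 / 30 by rw [bernoulli_eq_bernoulli'_of_ne_one (by norm_num), bernoulli'_four]]
  push_cast
  ring

theorem E2_slash_apply (γ : SL(2, ℤ)) (z : ℍ) :
    (EisensteinSeries.E2 ∣[(2 : ℤ)] γ) z =
      EisensteinSeries.E2 z + 12 * (2 * (Real.pi : ℂ) * Complex.I)⁻¹ *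
        (((γ 1 0 : ℤ) : ℂ) / denom γ z) := by
  have hπ : (Real.pi : ℂ) ≠ 0 := by exact_mod_cast Real.pi_ne_zero
  rw [EisensteinSeries.E2_slash_action]
  simp only [Pi.sub_apply, Pi.smul_apply, smul_eq_mul, EisensteinSeries.D2, riemannZeta_two]
  have hI := Complex.I_sq
  field_simp
  linear_combination (-12 * ((γ 1 0 : ℤ) : ℂ)) * hI

/-- The coefficient `-1/(4πi)` in the transformation law of `G₂`. -/
def kappa : ℂ := -(4 * (Real.pi : ℂ) * Complex.I)⁻¹

theorem kappa_ne_zero : kappa ≠ 0 := by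
  simp [kappa, Real.pi_ne_zero]

/-- The failure of modularity is linear in the lower left entry with a nonzero constant; this is
what separates powers of `G2` from modular forms below. -/
theorem G2_smul (γ : SL(2, ℤ)) (z : ℍ) :
    G2 (γ • z) = denom γ z ^ 2 * G2 z + kappa * ((γ 1 0 : ℤ) : ℂ) * denom γ z := by
  have hj := denom_ne_zero γ z
  have h := E2_slash_apply γ z
  rw [ModularForm.SL_slash_apply, zpow_neg, ← div_eq_mul_inv, div_eq_iff (zpow_ne_zero _ hj)] at h
  rw [G2_eq, G2_eq, h, kappa]
  have hπ : (Real.pi : ℂ) ≠ 0 := by exact_mod_cast Real.pi_ne_zero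
  rw [show ((2 : ℤ)) = ((2 : ℕ) : ℤ) from rfl, zpow_natCast]
  have hI := Complex.I_ne_zero
  field_simp
  ring

theorem mdifferentiable_G2 : MDiff G2 := by
  have : G2 = fun z => -(1 / 24) * EisensteinSeries.E2 z := funext G2_eq
  rw [this]
  exact mdifferentiable_const.mul E2_mdifferentiable

theorem isBoundedAtImInfty_const_mul {f : ℍ → ℂ} (c : ℂ) (hf : IsBoundedAtImInfty f) :
    IsBoundedAtImInfty fun z => c * f z :=
  Asymptotics.IsBigO.const_mul_left hf c

/-- `G₂` and its translates are bounded at infinity. -/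
theorem isBoundedAtImInfty_G2_slash (γ : SL(2, ℤ)) : IsBoundedAtImInfty (G2 ∣[(2 : ℤ)] γ) := by
  have h : (G2 ∣[(2 : ℤ)] γ) = fun z => -(1 / 24) * EisensteinSeries.E2 z +
      kappa * (((γ 1 0 : ℤ) : ℂ) * (denom γ z)⁻¹) := by
    ext z
    have hj := denom_ne_zero γ z
    rw [ModularForm.SL_slash_apply, G2_smul, G2_eq, zpow_neg,
      show ((2 : ℤ)) = ((2 : ℕ) : ℤ) from rfl, zpow_natCast]
    field_simp
  rw [h]
  refine (isBoundedAtImInfty_const_mul _ EisensteinSeries.isBoundedAtImInfty_E2).add ?_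
  refine isBoundedAtImInfty_const_mul _ ?_
  by_cases hc : γ 1 0 = 0
  · simp only [hc, Int.cast_zero, zero_mul]
    exact zero_form_isBoundedAtImInfty
  -- For c ≠ 0 and Im z ≥ 1, |cz + d| ≥ |c| Im z ≥ |c|.
  · rw [isBoundedAtImInfty_iff]
    refine ⟨1, 1, fun z hz => ?_⟩
    rw [← div_eq_mul_inv, norm_div, div_le_one (norm_pos_iff.mpr (denom_ne_zero γ z))]
    have him : (denom γ z).im = (γ 1 0 : ℝ) * z.im := by
      simp [ModularGroup.denom_apply]
    calc ‖((γ 1 0 : ℤ) : ℂ)‖ = |(γ 1 0 : ℝ)| := by simp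
      _ ≤ |(γ 1 0 : ℝ)| * z.im := le_mul_of_one_le_right (abs_nonneg _) hz
      _ = |(denom γ z).im| := by rw [him, abs_mul, abs_of_pos z.im_pos]
      _ ≤ ‖denom γ z‖ := Complex.abs_im_le_norm _

/-! ### Ramanujan's identity -/

/-- Cauchy's estimate on the unit circle around z. -/
theorem isZeroAtImInfty_normalizedDeriv {f : ℍ → ℂ} (hf : MDiff f) (h0 : IsZeroAtImInfty f) :
    IsZeroAtImInfty (Derivative.normalizedDerivOfComplex f) := by
  rw [isZeroAtImInfty_iff] at h0 ⊢
  intro ε hε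
  have hπ : (2 * Real.pi * ε) > 0 := by positivity
  obtain ⟨A, hA⟩ := h0 _ hπ
  -- The margin keeps the closed unit disc around z inside the upper half plane and above height A.
  refine ⟨max A 0 + 2, fun z hz => ?_⟩
  have hA0 := le_max_left A 0
  have hA1 := le_max_right A 0
  have him : ∀ w ∈ Metric.closedBall (z : ℂ) 1, max A 0 + 1 ≤ w.im := by
    intro w hw
    rw [Metric.mem_closedBall, dist_eq_norm] at hw
    have h1 := (Complex.abs_im_le_norm (w - z)).trans hw
    rw [Complex.sub_im, abs_le] at h1
    have : (z : ℂ).im = z.im := rfl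
    linarith
  have hd : DifferentiableOn ℂ (f ∘ ofComplex) {w | 0 < w.im} := mdifferentiable_iff.mp hf
  have key := Complex.norm_deriv_le_of_forall_mem_sphere_norm_le (c := (z : ℂ)) (R := 1)
    (C := 2 * Real.pi * ε) (f := f ∘ ofComplex) one_pos ?_ ?_
  · rw [Derivative.normalizedDerivOfComplex, norm_mul, norm_inv]
    have : ‖(2 * (Real.pi : ℂ) * Complex.I)‖ = 2 * Real.pi := by
      simp [abs_of_pos Real.pi_pos]
    rw [this, inv_mul_le_iff₀ (by positivity)]
    simpa using key
  · apply DifferentiableOn.diffContOnCl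
    rw [closure_ball _ one_ne_zero]
    exact hd.mono fun w hw => by
      have := him w hw
      simp only [Set.mem_ofPred_eq]
      linarith
  · intro w hw
    have hw' := him w (Metric.sphere_subset_closedBall hw)
    have hpos : 0 < w.im := by linarith
    rw [Function.comp_apply, ofComplex_apply_of_im_pos hpos]
    apply hA
    change A ≤ w.im
    linarith

/-- The quotient (f - c₀)/q again has a q-expansion, hence is bounded at infinity, while q tends to
0. -/
theorem tendsto_atImInfty_of_hasSum_qExpansion {f : ℍ → ℂ} {c : ℕ → ℂ}
    (hf : ∀ τ : ℍ, HasSum (fun m ↦ c m • Function.Periodic.qParam 1 τ ^ m) (f τ)) :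
    Filter.Tendsto f atImInfty (nhds (c 0)) := by
  let h : ℍ → ℂ := fun τ => (f τ - c 0) / Function.Periodic.qParam 1 τ
  have hq : ∀ τ : ℍ, Function.Periodic.qParam 1 τ ≠ 0 := fun τ => Function.Periodic.qParam_ne_zero _
  have hh : IsBoundedAtImInfty h := by
    refine isBoundedAtImInfty_of_hasSum_qExpansion (h := 1) (c := fun m => c (m + 1)) one_pos
      fun τ => ?_
    have h1 := (((hasSum_nat_add_iff' 1).mpr (hf τ))).div_const (Function.Periodic.qParam 1 τ)
    simp only [Finset.sum_range_one, pow_zero, smul_eq_mul, mul_one] at h1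
    refine h1.congr_fun fun m => ?_
    have := hq τ
    rw [smul_eq_mul, pow_succ]
    field_simp
  have h0 : Filter.Tendsto (fun τ : ℍ => Function.Periodic.qParam 1 τ * h τ) atImInfty (nhds 0) := by
    have := (Asymptotics.isBigO_refl (fun τ : ℍ => Function.Periodic.qParam 1 τ) atImInfty).norm_right.mul
      (show h =O[atImInfty] (1 : ℍ → ℝ) from hh)
    refine this.trans_tendsto ?_
    simpa using (qParam_tendsto_atImInfty one_pos).norm
  have hfe : f = fun τ : ℍ => c 0 + Function.Periodic.qParam 1 τ * h τ := by
    ext τ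
    have := hq τ
    simp only [h]
    field_simp
    ring
  rw [hfe]
  simpa using h0.const_add (c 0)

theorem tendsto_E2_atImInfty : Filter.Tendsto EisensteinSeries.E2 atImInfty (nhds 1) := by
  have h := tendsto_atImInfty_of_hasSum_qExpansion (f := EisensteinSeries.E2)
    (c := fun m => if m = 0 then 1 else -24 * (ArithmeticFunction.sigma 1 m : ℂ))
    fun τ => by
      simpa only [Function.Periodic.qParam, Complex.ofReal_one, div_one] using
        EisensteinSeries.hasSum_qExpansion_E2 (z := τ)
  rwa [if_pos rfl] at h

theorem tendsto_E4_atImInfty : Filter.Tendsto (ModularForm.E₄ : ℍ → ℂ) atImInfty (nhds 1) := by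
  have h := tendsto_atImInfty_of_hasSum_qExpansion (f := ModularForm.E₄)
    (c := fun m => (qExpansion 1 ModularForm.E₄).coeff m)
    fun τ => ModularForm.hasSum_qExpansion ModularForm.E₄ one_pos (by simp) τ
  simpa only [EisensteinSeries.E_qExpansion_coeff_zero (by norm_num : 3 ≤ 4) ⟨2, rfl⟩] using h

/-- Differentiate the transformation law of E₂ and compare with the general rule for the derivative
of a slashed function. -/
theorem normalizedDeriv_E2_slash (γ : SL(2, ℤ)) (z : ℍ) :
    (Derivative.normalizedDerivOfComplex EisensteinSeries.E2 ∣[(4 : ℤ)] γ) z =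
      Derivative.normalizedDerivOfComplex EisensteinSeries.E2 z +
        12 * (2 * (Real.pi : ℂ) * Complex.I)⁻¹ ^ 2 * (((γ 1 0 : ℤ) : ℂ) / denom γ z) ^ 2 +
        2 * (2 * (Real.pi : ℂ) * Complex.I)⁻¹ * (((γ 1 0 : ℤ) : ℂ) / denom γ z) *
          EisensteinSeries.E2 z := by
  have h := congrFun (Derivative.normalizedDerivOfComplex_SL_slash (k := 2)
    E2_mdifferentiable (γ := γ)) z
  simp only [Pi.sub_apply, E2_slash_apply] at h
  have hj := denom_ne_zero γ z
  have hd : HasDerivAt (fun w : ℂ => (denom γ w) ^ (-1 : ℤ))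
      (-((γ 1 0 : ℤ) : ℂ) * (denom γ z) ^ (-2 : ℤ)) (z : ℂ) := by
    simpa using hasDerivAt_denom_zpow γ (-1) z
  have hE : HasDerivAt (EisensteinSeries.E2 ∘ ofComplex)
      (deriv (EisensteinSeries.E2 ∘ ofComplex) (z : ℂ)) (z : ℂ) :=
    (mdifferentiableAt_iff.mp (E2_mdifferentiable z)).hasDerivAt
  have hs : ((EisensteinSeries.E2 ∣[(2 : ℤ)] γ) ∘ ofComplex) =ᶠ[nhds (z : ℂ)]
      fun w => (EisensteinSeries.E2 ∘ ofComplex) w +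
        12 * (2 * (Real.pi : ℂ) * Complex.I)⁻¹ * ((γ 1 0 : ℤ) : ℂ) * (denom γ w) ^ (-1 : ℤ) := by
    filter_upwards [isOpen_upperHalfPlaneSet.mem_nhds z.im_pos] with w hw
    rw [Function.comp_apply, E2_slash_apply, Function.comp_apply, ofComplex_apply_of_im_pos hw,
      zpow_neg_one, div_eq_mul_inv, mul_assoc _ (((γ 1 0 : ℤ) : ℂ))]
  have hD : Derivative.normalizedDerivOfComplex (EisensteinSeries.E2 ∣[(2 : ℤ)] γ) z =
      Derivative.normalizedDerivOfComplex EisensteinSeries.E2 z -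
        12 * (2 * (Real.pi : ℂ) * Complex.I)⁻¹ ^ 2 * (((γ 1 0 : ℤ) : ℂ) / denom γ z) ^ 2 := by
    rw [Derivative.normalizedDerivOfComplex, ((hE.add (hd.const_mul _)).congr_of_eventuallyEq hs).deriv,
      Derivative.normalizedDerivOfComplex, zpow_neg, show ((2 : ℤ)) = ((2 : ℕ) : ℤ) from rfl,
      zpow_natCast]
    field_simp
    ring
  rw [hD] at h
  simp only [show (2 : ℤ) + 2 = 4 from rfl, Int.cast_ofNat] at h
  linear_combination -h

/-- The anomalies of the derivative of E₂ and of E₂²/12 cancel. -/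
theorem serreDerivative_E2_slash (γ : SL(2, ℤ)) :
    Derivative.serreDerivative 1 EisensteinSeries.E2 ∣[(4 : ℤ)] γ =
      Derivative.serreDerivative 1 EisensteinSeries.E2 := by
  ext z
  have h1 := normalizedDeriv_E2_slash γ z
  have h2 := E2_slash_apply γ z
  rw [ModularForm.SL_slash_apply] at h1 h2 ⊢
  rw [show (-4 : ℤ) = -2 + -2 by norm_num, zpow_add₀ (denom_ne_zero γ z)] at h1 ⊢
  simp only [Derivative.serreDerivative_apply]
  -- The multiplier of `h2` is the sum of its two sides, so the product is the difference of their
  -- squares.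
  linear_combination h1 - 1 / 12 * (EisensteinSeries.E2 (γ • z) * denom γ z ^ (-2 : ℤ) +
    EisensteinSeries.E2 z +
      12 * (2 * (Real.pi : ℂ) * Complex.I)⁻¹ * (((γ 1 0 : ℤ) : ℂ) / denom γ z)) * h2

theorem tendsto_serreDerivative_E2 :
    Filter.Tendsto (Derivative.serreDerivative 1 EisensteinSeries.E2) atImInfty
      (nhds (-(1 / 12))) := by
  have h1 : IsZeroAtImInfty (Derivative.normalizedDerivOfComplex EisensteinSeries.E2) := by
    have hc : MDiff (fun _ : ℍ => (1 : ℂ)) := mdifferentiable_const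
    have h := isZeroAtImInfty_normalizedDeriv (E2_mdifferentiable.sub hc)
      (show Filter.Tendsto (fun z => EisensteinSeries.E2 z - 1) atImInfty (nhds 0) by
        simpa using tendsto_E2_atImInfty.sub_const 1)
    rwa [Derivative.normalizedDerivOfComplex_sub _ _ E2_mdifferentiable hc,
      Derivative.normalizedDerivOfComplex_const, sub_zero] at h
  have h2 := h1.sub ((tendsto_E2_atImInfty.const_mul (1 * 12⁻¹ : ℂ)).mul tendsto_E2_atImInfty)
  rw [Derivative.serreDerivative_eq]
  convert h2 using 2
  norm_num

/-- The Serre derivative of `E₂` as a modular form of weight four. -/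
def serreDerivativeE2 : ModularForm 𝒮ℒ 4 where
  toFun := Derivative.serreDerivative 1 EisensteinSeries.E2
  slash_action_eq' := fun _ ⟨γ, hγ⟩ ↦ hγ ▸ serreDerivative_E2_slash γ
  holo' := Derivative.serreDerivative_mdifferentiable 1 E2_mdifferentiable
  bdd_at_cusps' {c} hc := by
    rw [Subgroup.IsArithmetic.isCusp_iff_isCusp_SL2Z] at hc
    rw [OnePoint.isBoundedAt_iff_forall_SL2Z hc]
    intro γ _
    rw [serreDerivative_E2_slash γ]
    exact tendsto_serreDerivative_E2.isBigO_one ℝ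

/-- Level one forms of weight four are multiples of E₄; the limits at infinity determine the factor.
-/
theorem serreDerivative_E2 (z : ℍ) :
    Derivative.serreDerivative 1 EisensteinSeries.E2 z = -(1 / 12) * ModularForm.E₄ z := by
  obtain ⟨c, hc⟩ := exists_smul_eq_of_finrank_eq_one
    (Module.rank_eq_one_iff_finrank_eq_one.mp ModularForm.levelOne_weight_four_rank_one)
    (EisensteinSeries.E_ne_zero (by norm_num : 3 ≤ 4) ⟨2, rfl⟩) serreDerivativeE2
  have hfun : ∀ z : ℍ, Derivative.serreDerivative 1 EisensteinSeries.E2 z =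
      c * ModularForm.E₄ z := fun z => (DFunLike.congr_fun hc z).symm
  have hlim : Filter.Tendsto (Derivative.serreDerivative 1 EisensteinSeries.E2) atImInfty
      (nhds (c * 1)) := by
    rw [funext hfun]
    exact tendsto_E4_atImInfty.const_mul c
  rw [hfun, ← mul_one c, tendsto_nhds_unique hlim tendsto_serreDerivative_E2]

/-- Ramanujan's formula for the derivative of `G₂`. -/
theorem G2'_eq (z : ℍ) :
    G2' z = 2 * (Real.pi : ℂ) * Complex.I * (-2 * G2 z ^ 2 + 5 / 6 * G4 z) := by
  have h := serreDerivative_E2 z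
  rw [Derivative.serreDerivative_apply] at h
  have hG : G2 = (-(1 / 24) : ℂ) • EisensteinSeries.E2 := funext G2_eq
  have hD := congrFun (Derivative.normalizedDerivOfComplex_smul (-(1 / 24)) _
    E2_mdifferentiable) z
  rw [← hG, Derivative.normalizedDerivOfComplex, inv_mul_eq_iff_eq_mul₀ Complex.two_pi_I_ne_zero]
    at hD
  rw [G2', hD, G2_eq, G4_eq, Pi.smul_apply, smul_eq_mul]
  linear_combination (-(1 / 24) * (2 * (Real.pi : ℂ) * Complex.I)) * h

/-! ### The modular tower -/

theorem toReal_mul (α β : GQ) : toReal (α * β) = toReal α * toReal β := by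
  simp [toReal]

theorem det_toReal_pos (α : GQ) : 0 < (toReal α).det.val := by
  have h := α.2
  rw [Matrix.mem_glpos] at h
  simpa [toReal, Matrix.GeneralLinearGroup.map_det] using h

theorem sigma_toReal (α : GQ) (z : ℂ) : σ (toReal α) z = z := by
  rw [σ, if_pos (det_toReal_pos α)]
  rfl

theorem toReal_toGQ (γ : SL(2, ℤ)) :
    toReal (toGQ γ) = Matrix.SpecialLinearGroup.mapGL ℝ γ := by
  ext i j
  simp [toReal, toGQ]

theorem slash_apply (w : ℕ) (α : GQ) (f : ℍ → ℂ) (z : ℍ) :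
    slash w α f z = (denom (toReal α) z) ^ (-(w : ℤ)) * f (toReal α • z) := rfl

theorem slash_mul_right (w : ℕ) (α β : GQ) (f : ℍ → ℂ) :
    slash w (α * β) f = slash w β (slash w α f) := by
  ext z
  simp only [slash_apply, toReal_mul, mul_smul]
  rw [denom_cocycle_σ, sigma_toReal, mul_zpow]
  ring

theorem slash_mul (w w' : ℕ) (α : GQ) (f g : ℍ → ℂ) :
    slash (w + w') α (f * g) = slash w α f * slash w' α g := by
  ext z
  simp only [slash_apply, Pi.mul_apply, Nat.cast_add, neg_add, zpow_add₀ (denom_ne_zero _ z)]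
  ring

theorem slash_toGQ (w : ℕ) (γ : SL(2, ℤ)) (f : ℍ → ℂ) :
    slash w (toGQ γ) f = f ∣[(w : ℤ)] γ := by
  ext z
  rw [slash_apply, ModularForm.SL_slash_apply, toReal_toGQ, mul_comm]
  rfl

/-- The two slash actions differ by a power of the determinant, a nonzero constant, so membership
results transfer. -/
theorem slash_eq_smul (w : ℕ) (α : GQ) (f : ℍ → ℂ) :
    slash w α f = (((|(toReal α).det.val| : ℝ) : ℂ) ^ ((w : ℤ) - 1))⁻¹ • (f ∣[(w : ℤ)] toReal α) := by
  have hd : (((|(toReal α).det.val| : ℝ) : ℂ)) ≠ 0 := by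
    exact_mod_cast (abs_pos.mpr (det_toReal_pos α).ne').ne'
  ext z
  simp only [slash_apply, Pi.smul_apply, ModularForm.slash_apply, sigma_toReal, smul_eq_mul]
  field_simp

/-- A holomorphic function, invariant under `Γ(N)` and bounded at all cusps, as a modular form. -/
def mkModularForm {N : ℕ} [NeZero N] {w : ℤ} {f : ℍ → ℂ} (h1 : MDiff f)
    (h2 : ∀ γ ∈ CongruenceSubgroup.Gamma N, f ∣[w] γ = f)
    (h3 : ∀ γ : SL(2, ℤ), IsBoundedAtImInfty (f ∣[w] γ)) : ModularForm (levelR N) w where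
  toFun := f
  slash_action_eq' := fun _ ⟨γ, hγ, e⟩ => e ▸ h2 γ hγ
  holo' := h1
  bdd_at_cusps' := fun {c} hc => by
    rw [Subgroup.IsArithmetic.isCusp_iff_isCusp_SL2Z] at hc
    rw [OnePoint.isBoundedAt_iff_forall_SL2Z hc]
    exact fun γ _ => h3 γ

theorem isModularForm_iff {N w : ℕ} (hN : 1 ≤ N) {f : ℍ → ℂ} :
    IsModularForm N w f ↔ MDiff f ∧
      (∀ γ ∈ CongruenceSubgroup.Gamma N, f ∣[(w : ℤ)] γ = f) ∧
      ∀ γ : SL(2, ℤ), IsBoundedAtImInfty (f ∣[(w : ℤ)] γ) := by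
  have : NeZero N := ⟨by omega⟩
  constructor
  · rintro ⟨g, rfl⟩
    exact ⟨g.holo', fun γ hγ => g.slash_action_eq' _ ⟨γ, hγ, rfl⟩,
      fun γ => ModularFormClass.bdd_at_infty_slash g γ⟩
  · rintro ⟨h1, h2, h3⟩
    exact ⟨mkModularForm h1 h2 h3, rfl⟩

theorem mul_mem_modularTower {w w' : ℕ} {f g : ℍ → ℂ} (hf : f ∈ modularTower w)
    (hg : g ∈ modularTower w') : f * g ∈ modularTower (w + w') := by
  obtain ⟨N, hN, hf⟩ := hf
  obtain ⟨N', hN', hg⟩ := hg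
  obtain ⟨f', rfl⟩ := hf.mono (Dvd.intro N' rfl)
  obtain ⟨g', rfl⟩ := hg.mono (Dvd.intro_left N rfl)
  have : NeZero (N * N') := ⟨(Nat.mul_pos hN hN').ne'⟩
  exact ⟨N * N', Nat.mul_pos hN hN', (f'.mul g').mcast (by push_cast; rfl), rfl⟩

theorem one_mem_modularTower : (1 : ℍ → ℂ) ∈ modularTower 0 :=
  ⟨1, le_rfl, (1 : ModularForm (levelR 1) 0), rfl⟩

theorem pow_mem_modularTower {w : ℕ} {f : ℍ → ℂ} (hf : f ∈ modularTower w) (m : ℕ) :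
    f ^ m ∈ modularTower (w * m) := by
  induction m with
  | zero => simpa using one_mem_modularTower
  | succ m ih => exact mul_mem_modularTower ih hf

theorem G4_slash (γ : SL(2, ℤ)) : G4 ∣[(4 : ℤ)] γ = G4 := by
  have h : G4 = (1 / 240 : ℂ) • (ModularForm.E₄ : ℍ → ℂ) := funext G4_eq
  rw [h, ModularForm.SL_smul_slash]
  congr 1
  exact ModularForm.E₄.slash_action_eq' _ ⟨γ, rfl⟩

theorem G4_mem_modularTower : G4 ∈ modularTower 4 := by
  have h : G4 = (1 / 240 : ℂ) • (ModularForm.E₄ : ℍ → ℂ) := funext G4_eq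
  rw [h]
  refine Submodule.smul_mem _ _ ⟨1, le_rfl, (isModularForm_iff le_rfl).mpr
    ⟨ModularForm.E₄.holo', fun γ _ => ModularForm.E₄.slash_action_eq' _ ⟨γ, rfl⟩,
      fun γ => ModularFormClass.bdd_at_infty_slash ModularForm.E₄ γ⟩⟩

open scoped Pointwise in
-- The conjugate of Γ(N) by α contains some Γ(N'), so translation by α only changes the level.
theorem slash_mem_modularTower {w : ℕ} {f : ℍ → ℂ} (α : GQ) (hf : f ∈ modularTower w) :
    slash w α f ∈ modularTower w := by
  obtain ⟨N, hN, g, rfl⟩ := hf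
  have : NeZero N := ⟨by omega⟩
  obtain ⟨N', hN', hle⟩ := CongruenceSubgroup.exists_Gamma_le_conj' (α : GL (Fin 2) ℚ) N
  have hle' : levelR N' ≤ ConjAct.toConjAct (toReal α)⁻¹ • levelR N := by
    rw [ConjAct.toConjAct_inv, ← Subgroup.pointwise_smul_subset_iff]
    exact hle
  rw [slash_eq_smul]
  refine Submodule.smul_mem _ _ ⟨N', Nat.one_le_iff_ne_zero.mpr hN', ?_⟩
  let t : ModularForm _ (w : ℤ) := ModularForm.translate g (toReal α)
  exact ⟨{ toFun := t
           slash_action_eq' := fun γ hγ => t.slash_action_eq' γ (hle' hγ)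
           holo' := t.holo'
           bdd_at_cusps' := fun hc => t.bdd_at_cusps' (hc.mono hle') }, rfl⟩

theorem G4_pow_slash (m : ℕ) (γ : SL(2, ℤ)) :
    slash (4 * m) (toGQ γ) (G4 ^ m) = G4 ^ m := by
  induction m with
  | zero => ext z; simp [slash_apply]
  | succ m ih =>
    rw [Nat.mul_succ, pow_succ, slash_mul, ih, slash_toGQ]
    exact congrArg _ (G4_slash γ)

theorem nu_mem_modularTower (m : ℕ) (α : GQ) : nu m α ∈ modularTower (4 * m) :=
  Submodule.smul_mem _ _ (Submodule.sub_mem _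
    (slash_mem_modularTower α (pow_mem_modularTower G4_mem_modularTower m))
    (pow_mem_modularTower G4_mem_modularTower m))

/-- Since G₄^m is fixed by SL₂(ℤ), ν depends only on the coset of α; the same invariance gives the
right equivariance needed for `HeckeOps`. -/
theorem nu_mul_left (m : ℕ) (γ : SL(2, ℤ)) (α : GQ) : nu m (toGQ γ * α) = nu m α := by
  rw [nu, slash_mul_right, G4_pow_slash, nu]

theorem nu_mul_right (m : ℕ) (γ : SL(2, ℤ)) (α : GQ) :
    nu m (α * toGQ γ) = slash (4 * m) (toGQ γ) (nu m α) := by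
  rw [nu, slash_mul_right, nu, map_smul, map_sub, G4_pow_slash]

/-- Modular forms of negative weight vanish. -/
theorem eq_zero_of_slash_invariant_of_neg {N : ℕ} (hN : 1 ≤ N) {w : ℤ} (hw : w < 0) {f : ℍ → ℂ}
    (h1 : MDiff f) (h2 : ∀ γ ∈ CongruenceSubgroup.Gamma N, f ∣[w] γ = f)
    (h3 : ∀ γ : SL(2, ℤ), IsBoundedAtImInfty (f ∣[w] γ)) : f = 0 := by
  have : NeZero N := ⟨by omega⟩
  exact congrArg DFunLike.coe (ModularForm.isZero_of_neg_weight hw (mkModularForm h1 h2 h3))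

/-! ### Uniqueness of the expansion in powers of `G₂` -/

/-- An element of `Γ(N)` with lower row `(Nm, 1 + N²mn)`. -/
def gammaElt (N : ℕ) (m n : ℤ) : SL(2, ℤ) :=
  ⟨!![1, N * n; N * m, 1 + N * m * (N * n)], by simp [Matrix.det_fin_two]; ring⟩

theorem gammaElt_mem (N : ℕ) (m n : ℤ) : gammaElt N m n ∈ CongruenceSubgroup.Gamma N := by
  rw [CongruenceSubgroup.Gamma_mem]
  simp [gammaElt]

theorem denom_gammaElt (N : ℕ) (m n : ℤ) (z : ℍ) :
    denom (gammaElt N m n) z = (N * m : ℂ) * z + (1 + N * m * (N * n)) := by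
  rw [ModularGroup.denom_apply]
  simp [gammaElt]

theorem infinite_range_denom {N : ℕ} (hN : 1 ≤ N) {m : ℤ} (hm : m ≠ 0) (z : ℍ) :
    (Set.range fun n : ℤ => denom (gammaElt N m n) z).Infinite := by
  refine Set.infinite_range_of_injective fun n n' h => ?_
  have hN' : (N : ℂ) ≠ 0 := by exact_mod_cast (by omega : N ≠ 0)
  have hm' : (m : ℂ) ≠ 0 := by exact_mod_cast hm
  simp only [denom_gammaElt] at h
  have h' : (N * m * N : ℂ) * n = (N * m * N : ℂ) * n' := by linear_combination h
  exact_mod_cast mul_left_cancel₀ (mul_ne_zero (mul_ne_zero hN' hm') hN') h'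

theorem eval_eq_zero_of_infinite (P : Polynomial ℂ) {s : Set ℂ} (hs : s.Infinite)
    (h : ∀ x ∈ s, P.eval x = 0) (x : ℂ) : P.eval x = 0 := by
  rw [Polynomial.eq_zero_of_infinite_isRoot P (hs.mono fun x hx => h x hx), Polynomial.eval_zero]

/-- Linear independence of the monomials `J^{w+i} M^i`. -/
theorem eq_zero_of_sum_monomials_eq_zero (S : Finset (ℕ × ℕ)) (a : ℕ × ℕ → ℂ)
    (h : ∀ J M : ℂ, ∑ p ∈ S, a p * J ^ (p.2 + p.1) * M ^ p.1 = 0) :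
    ∀ p ∈ S, a p = 0 := by
  obtain ⟨B, hB⟩ : ∃ B, ∀ p ∈ S, p.2 ≤ B := ⟨S.sup Prod.snd, fun p hp => Finset.le_sup (f := Prod.snd) hp⟩
  -- Substituting M = J^B turns the monomial of (i, w) into J^((B+1)i + w); as w ≤ B on `S`, the
  -- exponent determines (i, w).
  let e : ℕ × ℕ → ℕ := fun p => p.2 + p.1 + B * p.1
  have he : ∀ p ∈ S, ∀ q ∈ S, e p = e q → p = q := by
    rintro ⟨i, w⟩ hp ⟨i', w'⟩ hq heq
    have h1 := hB _ hp
    have h2 := hB _ hq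
    simp only [e] at h1 h2 heq
    have h3 : i = i' := by
      by_contra hne
      rcases Nat.lt_or_gt_of_ne hne with hlt | hlt
      · nlinarith
      · nlinarith
    subst h3
    simp only [Prod.mk.injEq, true_and]
    omega
  let P : Polynomial ℂ := ∑ p ∈ S, Polynomial.C (a p) * Polynomial.X ^ e p
  have hP : P = 0 := by
    refine Polynomial.funext fun x => ?_
    simp only [P, Polynomial.eval_finsetSum, Polynomial.eval_mul, Polynomial.eval_C,
      Polynomial.eval_pow, Polynomial.eval_X, Polynomial.eval_zero]
    rw [← h x (x ^ B)]
    refine Finset.sum_congr rfl fun p _ => ?_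
    simp only [e]
    rw [pow_add, pow_mul, mul_assoc]
  intro p hp
  have hc : P.coeff (e p) = a p := by
    simp only [P, Polynomial.finsetSum_coeff, Polynomial.coeff_C_mul_X_pow]
    rw [Finset.sum_eq_single p]
    · simp
    · intro q hq hqp
      rw [if_neg fun h => hqp (he p hp q hq h).symm]
    · exact fun h => absurd hp h
  rw [← hc, hP, Polynomial.coeff_zero]

/-- Evaluate the relation at γz with z fixed: it becomes polynomial in J = cz + d and c, with `G2`
contributing J(κc + G₂(z)J). For fixed c ≠ 0 infinitely many J occur, and then infinitely many c, so
it holds for all complex J and c. -/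
theorem eq_zero_of_sum_modular_mul_G2_pow_eq_zero {N : ℕ} (hN : 1 ≤ N) (S : Finset (ℕ × ℕ))
    (a : ℕ × ℕ → ℍ → ℂ)
    (ha : ∀ p ∈ S, ∀ γ ∈ CongruenceSubgroup.Gamma N, a p ∣[(p.2 : ℤ)] γ = a p)
    (h : ∀ z, ∑ p ∈ S, a p z * G2 z ^ p.1 = 0) : ∀ p ∈ S, ∀ z, a p z = 0 := by
  intro p hp z
  have h1 : ∀ m n : ℤ, ∑ p ∈ S, a p z * (denom (gammaElt N m n) z) ^ (p.2 + p.1) *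
      (kappa * (N * m) + G2 z * denom (gammaElt N m n) z) ^ p.1 = 0 := by
    intro m n
    rw [← h (gammaElt N m n • z)]
    refine Finset.sum_congr rfl fun p hp => ?_
    have hj := denom_ne_zero (gammaElt N m n) z
    have h2 := congrFun (ha p hp _ (gammaElt_mem N m n)) z
    rw [ModularForm.SL_slash_apply, zpow_neg, ← div_eq_mul_inv,
      div_eq_iff (zpow_ne_zero _ hj), zpow_natCast] at h2
    rw [h2, G2_smul, show gammaElt N m n 1 0 = N * m from rfl, pow_add, mul_assoc, mul_assoc,
      mul_assoc, ← mul_pow]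
    push_cast
    ring_nf
  have h2 : ∀ m : ℤ, m ≠ 0 → ∀ J : ℂ, ∑ p ∈ S, a p z * J ^ (p.2 + p.1) *
      (kappa * (N * m) + G2 z * J) ^ p.1 = 0 := by
    intro m hm J
    have h3 := eval_eq_zero_of_infinite (∑ p ∈ S, Polynomial.C (a p z) *
      Polynomial.X ^ (p.2 + p.1) * (Polynomial.C (kappa * (N * m)) +
        Polynomial.C (G2 z) * Polynomial.X) ^ p.1) (infinite_range_denom hN hm z) ?_ J
    · simpa [Polynomial.eval_finsetSum] using h3
    · rintro _ ⟨n, rfl⟩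
      simpa [Polynomial.eval_finsetSum] using h1 m n
  have hinf : (Set.range fun m : ℕ => (N : ℂ) * ((m : ℤ) + 1 : ℤ)).Infinite := by
    refine Set.infinite_range_of_injective fun n n' h => ?_
    have hN' : (N : ℂ) ≠ 0 := by exact_mod_cast (by omega : N ≠ 0)
    have h' := mul_left_cancel₀ hN' h
    have h'' : ((n : ℤ) + 1 : ℤ) = (n' : ℤ) + 1 := by exact_mod_cast h'
    omega
  have h4 : ∀ J c : ℂ, ∑ p ∈ S, a p z * J ^ (p.2 + p.1) *
      (kappa * c + G2 z * J) ^ p.1 = 0 := by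
    intro J c
    have h3 := eval_eq_zero_of_infinite (∑ p ∈ S, Polynomial.C (a p z * J ^ (p.2 + p.1)) *
      (Polynomial.C kappa * Polynomial.X + Polynomial.C (G2 z * J)) ^ p.1) hinf ?_ c
    · simpa [Polynomial.eval_finsetSum] using h3
    · rintro _ ⟨n, rfl⟩
      simpa [Polynomial.eval_finsetSum] using h2 ((n : ℤ) + 1) (by omega) J
  refine eq_zero_of_sum_monomials_eq_zero S (fun p => a p z) (fun J M => ?_) p hp
  -- Solving M = κc + G₂(z)J for c makes J and M independent variables.
  rw [← h4 J ((M - G2 z * J) / kappa)]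
  refine Finset.sum_congr rfl fun p _ => ?_
  rw [mul_div_cancel₀ _ kappa_ne_zero, sub_add_cancel]

theorem sumCoeffs_of (L : ℕ → ℕ → (ℍ → ℂ) →ₗ[ℂ] (ℍ → ℂ)) (i w : ℕ) (a : modularTower w) :
    sumCoeffs L (DirectSum.lof ℂ (ℕ × ℕ) (fun p => modularTower p.2) (i, w) a) = L i w a := by
  rw [sumCoeffs, DirectSum.toModule_lof]
  rfl

theorem polyG2_of (i w : ℕ) (a : modularTower w) :
    polyG2 (DirectSum.lof ℂ (ℕ × ℕ) (fun p => modularTower p.2) (i, w) a) = a * G2 ^ i :=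
  sumCoeffs_of _ i w a

open scoped Classical in
theorem polyG2_apply (c : Coeffs) (z : ℍ) :
    polyG2 c z = ∑ p ∈ DFinsupp.support c, (c p : ℍ → ℂ) z * G2 z ^ p.1 := by
  conv_lhs => rw [← DirectSum.sum_support_of c]
  rw [map_sum, Finset.sum_apply]
  exact Finset.sum_congr rfl fun p _ => congrFun (polyG2_of p.1 p.2 (c p)) z

theorem ker_polyG2 : LinearMap.ker polyG2 = ⊥ := by
  classical
  rw [LinearMap.ker_eq_bot']
  intro c hc
  have hlev : ∀ p : ℕ × ℕ, ∃ N : ℕ, 1 ≤ N ∧ IsModularForm N p.2 (c p) := fun p => (c p).2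
  choose lev hlev1 hlev2 using hlev
  set S := DFinsupp.support c with hS
  have hN : 1 ≤ ∏ p ∈ S, lev p := Finset.one_le_prod' fun p _ => hlev1 p
  have key := eq_zero_of_sum_modular_mul_G2_pow_eq_zero hN S (fun p => (c p : ℍ → ℂ)) ?_ ?_
  · ext p z
    by_cases hp : p ∈ S
    · simpa using key p hp z
    · rw [hS, DFinsupp.notMem_support_iff] at hp
      rw [hp]
      rfl
  · intro p hp
    exact ((isModularForm_iff hN).mp ((hlev2 p).mono (Finset.dvd_prod_of_mem lev hp))).2.1
  · intro z
    rw [← polyG2_apply, hc]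
    rfl

/-- Injectivity makes `coeffs` a genuine left inverse, so every operator can be computed on terms a
G₂^i. -/
theorem coeffs_polyG2 (c : Coeffs) : coeffs (polyG2 c) = c :=
  LinearMap.leftInverse_apply_of_inj ker_polyG2 c

theorem coeffs_mul_G2_pow {i w : ℕ} {a : ℍ → ℂ} (ha : a ∈ modularTower w) :
    coeffs (a * G2 ^ i) =
      DirectSum.lof ℂ (ℕ × ℕ) (fun p => modularTower p.2) (i, w) ⟨a, ha⟩ := by
  rw [← coeffs_polyG2 (DirectSum.lof ℂ (ℕ × ℕ) (fun p => modularTower p.2) (i, w) ⟨a, ha⟩),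
    polyG2_of]

/-! ### The structure theorem for quasimodular forms -/

/-- `f` transforms under `Γ(N)` like a quasimodular form of weight `k` and depth at most `s`, with
coefficient functions `φ_0, …, φ_s`. -/
structure HasExpansion (N k s : ℕ) (f : ℍ → ℂ) (φ : ℕ → ℍ → ℂ) : Prop where
  mdifferentiable : ∀ j ≤ s, MDiff (φ j)
  bounded : ∀ j ≤ s, ∀ γ : SL(2, ℤ),
    IsBoundedAtImInfty (φ j ∣[(k : ℤ) - 2 * (j : ℤ)] γ)
  smul_eq : ∀ γ ∈ CongruenceSubgroup.Gamma N, ∀ z : ℍ,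
    f (γ • z) = denom γ z ^ k *
      ∑ j ∈ Finset.range (s + 1), φ j z * (((γ 1 0 : ℤ) : ℂ) / denom γ z) ^ j

theorem isQuasimodularForm_iff {N k s : ℕ} {f : ℍ → ℂ} :
    IsQuasimodularForm N k s f ↔ (f = 0 ∧ s = 0) ∨
      (MDiff f ∧ ∃ φ, HasExpansion N k s f φ ∧ φ s ≠ 0) := by
  have key : ∀ (γ : SL(2, ℤ)) (z : ℍ) (x y : ℂ),
      denom γ z ^ (-(k : ℤ)) * x = y ↔ x = denom γ z ^ k * y := by
    intro γ z x y
    rw [zpow_neg, zpow_natCast,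
      inv_mul_eq_iff_eq_mul₀ (pow_ne_zero _ (denom_ne_zero γ z))]
  simp only [IsQuasimodularForm, ← ModularGroup.denom_apply, key]
  constructor
  · rintro (h | ⟨h, φ, h1, h2, h3, h4⟩)
    · exact .inl h
    · exact .inr ⟨h, φ, ⟨h1, h2, h4⟩, h3⟩
  · rintro (h | ⟨h, φ, ⟨h1, h2, h4⟩, h3⟩)
    · exact .inl h
    · exact .inr ⟨h, φ, h1, h2, h3, h4⟩

theorem denom_mul (δ γ : SL(2, ℤ)) (z : ℍ) :
    denom ((δ * γ : SL(2, ℤ)) : GL (Fin 2) ℝ) z =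
      denom δ ((γ • z : ℍ) : ℂ) * denom γ z := by
  have := denom_cocycle_σ (δ : GL (Fin 2) ℝ) (γ : GL (Fin 2) ℝ) z
  simpa [σ] using! this

namespace HasExpansion

variable {N k s : ℕ} {f g : ℍ → ℂ} {φ ψ : ℕ → ℍ → ℂ}

theorem zero_eq (h : HasExpansion N k s f φ) : f = φ 0 := by
  ext z
  have h1 := h.smul_eq 1 (one_mem _) z
  rw [Finset.sum_range_succ'] at h1
  simpa [denom_one] using h1

theorem sub_smul (h : HasExpansion N k s f φ) (h' : HasExpansion N k s g ψ) (c : ℂ) :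
    HasExpansion N k s (f - c • g) (fun j => φ j - c • ψ j) where
  mdifferentiable j hj := (h.mdifferentiable j hj).sub ((h'.mdifferentiable j hj).const_smul c)
  bounded j hj γ := by
    rw [sub_eq_add_neg (φ j), SlashAction.add_slash, SlashAction.neg_slash, ModularForm.SL_smul_slash]
    exact (h.bounded j hj γ).add ((h'.bounded j hj γ).smul c).neg_left
  smul_eq γ hγ z := by
    simp only [Pi.sub_apply, Pi.smul_apply, h.smul_eq γ hγ z, h'.smul_eq γ hγ z, smul_eq_mul,
      sub_mul, Finset.sum_sub_distrib, mul_sub, mul_assoc, ← Finset.mul_sum]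
    ring

theorem of_top_eq_zero (h : HasExpansion N k (s + 1) f φ) (h0 : φ (s + 1) = 0) :
    HasExpansion N k s f φ where
  mdifferentiable j hj := h.mdifferentiable j (by omega)
  bounded j hj := h.bounded j (by omega)
  smul_eq γ hγ z := by
    rw [h.smul_eq γ hγ z, Finset.sum_range_succ _ (s + 1), h0]
    simp

/-- Expand f(δγz) at γz via δ and at z via δγ. In the variable X = c_δ/(c_δ z' + d_δ), z' = γz, the
quotient for δγ is J⁻²X + c/J, so two polynomials of degree at most s agree at infinitely many X;
compare the coefficients of X^s. -/
theorem top_slash (hN : 1 ≤ N) (h : HasExpansion N k s f φ) {γ : SL(2, ℤ)}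
    (hγ : γ ∈ CongruenceSubgroup.Gamma N) : φ s ∣[(k : ℤ) - 2 * (s : ℤ)] γ = φ s := by
  ext z
  set z' : ℍ := γ • z with hz'
  set J := denom γ z with hJ
  have hJ0 : J ≠ 0 := denom_ne_zero γ z
  set c : ℂ := ((γ 1 0 : ℤ) : ℂ) with hc
  let P : Polynomial ℂ := ∑ j ∈ Finset.range (s + 1), (Polynomial.C (φ j z') *
    Polynomial.X ^ j - Polynomial.C (J ^ k * φ j z) *
      (Polynomial.C ((J ^ 2)⁻¹) * Polynomial.X + Polynomial.C (c / J)) ^ j)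
  have hinf : (Set.range fun n : ℤ => (N : ℂ) / denom (gammaElt N 1 n) z').Infinite := by
    have h1 := (infinite_range_denom hN one_ne_zero z').image
      (f := fun x => (N : ℂ) / x) (Function.Injective.injOn fun x y hxy => by
        have hN' : (N : ℂ) ≠ 0 := by exact_mod_cast (by omega : N ≠ 0)
        simpa [div_eq_mul_inv, hN'] using hxy)
    rwa [← Set.range_comp] at h1
  have hP : P = 0 := by
    refine Polynomial.eq_zero_of_infinite_isRoot P (hinf.mono ?_)
    rintro _ ⟨n, rfl⟩
    set δ := gammaElt N 1 n with hδ
    have hδ0 := denom_ne_zero δ z'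
    have hcoc := denom_mul δ γ z
    rw [← hz', ← hJ] at hcoc
    have hlow : (((δ * γ) 1 0 : ℤ) : ℂ) * J = N + c * (denom δ z' * J) := by
      have hd : (γ 0 0 : ℂ) * γ 1 1 - γ 0 1 * γ 1 0 = 1 := by
        have := γ.det_coe
        rw [Matrix.det_fin_two] at this
        exact_mod_cast this
      have hrow : ∀ j, (δ * γ) 1 j = N * γ 0 j + (1 + N * (N * n)) * γ 1 j := by
        intro j
        change (δ.1 * γ.1) 1 j = _
        rw [Matrix.mul_apply, Fin.sum_univ_two]
        simp [hδ, gammaElt]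
      rw [← hcoc, hJ, ModularGroup.denom_apply, ModularGroup.denom_apply, hrow, hrow]
      push_cast
      linear_combination (N : ℂ) * hd
    have e1 := h.smul_eq _ (gammaElt_mem N 1 n) z'
    have e2 := h.smul_eq (δ * γ) (mul_mem (gammaElt_mem N 1 n) hγ) z
    rw [mul_smul, ← hz', e1, hcoc, mul_pow, mul_assoc,
      mul_right_inj' (pow_ne_zero _ (denom_ne_zero _ _))] at e2
    have hquot : (((δ * γ) 1 0 : ℤ) : ℂ) / (denom δ z' * J) =
        (J ^ 2)⁻¹ * (N / denom δ z') + c / J := by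
      rw [div_eq_iff (mul_ne_zero hδ0 hJ0)]
      field_simp
      linear_combination hlow
    rw [hquot, show ((gammaElt N 1 n 1 0 : ℤ) : ℂ) = N by simp [gammaElt]] at e2
    simp only [P, Polynomial.IsRoot.def, Polynomial.eval_finsetSum, Polynomial.eval_sub,
      Polynomial.eval_mul, Polynomial.eval_C, Polynomial.eval_pow, Polynomial.eval_X,
      Polynomial.eval_add, Finset.sum_sub_distrib, mul_assoc, ← Finset.mul_sum]
    exact sub_eq_zero.mpr e2
  have hlin : (Polynomial.C ((J ^ 2)⁻¹) * Polynomial.X + Polynomial.C (c / J)).natDegree ≤ 1 :=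
    Polynomial.natDegree_linear_le
  have hcoeff : P.coeff s = φ s z' - J ^ k * φ s z * ((J ^ 2)⁻¹) ^ s := by
    simp only [P, Polynomial.finsetSum_coeff, Polynomial.coeff_sub, Polynomial.coeff_C_mul,
      Polynomial.coeff_X_pow]
    rw [Finset.sum_range_succ, Finset.sum_eq_zero, zero_add]
    · have h1 := Polynomial.coeff_pow_of_natDegree_le hlin (m := s)
      rw [mul_one] at h1
      rw [h1]
      simp
    · intro j hj
      rw [Finset.mem_range] at hj
      rw [if_neg (by omega), Polynomial.coeff_eq_zero_of_natDegree_lt]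
      · simp
      · exact (Polynomial.natDegree_pow_le_of_le j hlin).trans_lt (by omega)
  rw [hP, Polynomial.coeff_zero] at hcoeff
  rw [ModularForm.SL_slash_apply, ← hJ, ← hz', sub_eq_zero.mp hcoeff.symm, neg_sub, zpow_sub₀ hJ0,
    zpow_natCast, zpow_mul, zpow_natCast]
  have : (J ^ (2 : ℤ)) = J ^ 2 := by norm_cast
  rw [this, inv_pow]
  field_simp

end HasExpansion

/-- The binomial expansion of (κX + G₂)^i with X = c/(cz + d). The top coefficient is κ^i a, so such
terms can cancel any modular top coefficient. -/
theorem hasExpansion_mul_G2_pow {N w : ℕ} (hN : 1 ≤ N) {a : ℍ → ℂ} (ha : IsModularForm N w a)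
    (i : ℕ) : HasExpansion N (w + 2 * i) i (a * G2 ^ i)
      (fun j => (kappa ^ j * (i.choose j : ℂ)) • (a * G2 ^ (i - j))) := by
  obtain ⟨h1, h2, h3⟩ := (isModularForm_iff hN).mp ha
  refine ⟨fun j hj => ?_, fun j hj γ => ?_, fun γ hγ z => ?_⟩
  · exact (h1.mul (mdifferentiable_G2.pow _)).const_smul _
  · rw [ModularForm.SL_smul_slash]
    refine Asymptotics.IsBigO.const_smul_left ?_ _
    have hw : ((w + 2 * i : ℕ) : ℤ) - 2 * (j : ℤ) = w + 2 * ((i - j : ℕ) : ℤ) := by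
      push_cast [Nat.cast_sub hj]
      ring
    rw [hw]
    generalize i - j = m
    rw [ModularForm.mul_slash_SL2]
    have hb : IsBoundedAtImInfty ((G2 ^ m) ∣[(2 * (m : ℤ))] γ) := by
      induction m with
      | zero =>
        have : ((G2 ^ 0 : ℍ → ℂ) ∣[(2 * ((0 : ℕ) : ℤ))] γ) = fun _ => (1 : ℂ) := by
          ext z
          simp [ModularForm.SL_slash_apply]
        rw [this]
        exact Filter.const_boundedAtFilter _ _
      | succ m ih =>
        rw [Nat.cast_succ, mul_add, mul_one, pow_succ, ModularForm.mul_slash_SL2]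
        exact ih.mul (isBoundedAtImInfty_G2_slash γ)
    exact (h3 γ).mul hb
  · have hj := denom_ne_zero γ z
    have e := congrFun (h2 γ hγ) z
    rw [ModularForm.SL_slash_apply, zpow_neg, ← div_eq_mul_inv,
      div_eq_iff (zpow_ne_zero _ hj), zpow_natCast] at e
    have hG : G2 (γ • z) = denom γ z ^ 2 *
        (kappa * (((γ 1 0 : ℤ) : ℂ) / denom γ z) + G2 z) := by
      rw [G2_smul]
      field_simp
      ring
    simp only [Pi.mul_apply, Pi.pow_apply, Pi.smul_apply, smul_eq_mul]
    rw [e, hG, mul_pow, add_pow, pow_add, pow_mul, Finset.mul_sum, Finset.mul_sum, Finset.mul_sum]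
    refine Finset.sum_congr rfl fun j _ => ?_
    rw [mul_pow]
    ring

theorem mul_G2_pow_mem_range {i w : ℕ} {a : ℍ → ℂ} (ha : a ∈ modularTower w) :
    a * G2 ^ i ∈ LinearMap.range polyG2 :=
  ⟨_, polyG2_of i w ⟨a, ha⟩⟩

/-- Induction on the depth bound: the top coefficient is modular of weight k - 2s. It vanishes if
this weight is negative; otherwise subtracting κ^(-s) φ_s G₂^s removes it. -/
theorem HasExpansion.mem_range {N : ℕ} (hN : 1 ≤ N) {k s : ℕ} {f : ℍ → ℂ} {φ : ℕ → ℍ → ℂ}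
    (h : HasExpansion N k s f φ) : f ∈ LinearMap.range polyG2 := by
  induction s generalizing f φ with
  | zero =>
    have h0 : f ∈ modularTower k := by
      refine ⟨N, hN, (isModularForm_iff hN).mpr ?_⟩
      rw [h.zero_eq]
      refine ⟨h.mdifferentiable 0 le_rfl, fun γ hγ => ?_, fun γ => ?_⟩
      · simpa using h.top_slash hN hγ
      · simpa using h.bounded 0 le_rfl γ
    simpa using mul_G2_pow_mem_range (i := 0) h0
  | succ s ih =>
    have h1 := h.mdifferentiable (s + 1) le_rfl
    have h2 : ∀ γ ∈ CongruenceSubgroup.Gamma N, _ := fun γ hγ => h.top_slash hN hγ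
    have h3 := h.bounded (s + 1) le_rfl
    rcases lt_or_ge k (2 * (s + 1)) with hk | hk
    · exact ih (h.of_top_eq_zero (eq_zero_of_slash_invariant_of_neg hN (by omega) h1 h2 h3))
    · obtain ⟨w, rfl⟩ := Nat.exists_eq_add_of_le' hk
      have hw : ((w + 2 * (s + 1) : ℕ) : ℤ) - 2 * ((s + 1 : ℕ) : ℤ) = w := by
        push_cast
        ring
      rw [hw] at h2 h3
      have ha : IsModularForm N w (φ (s + 1)) := (isModularForm_iff hN).mpr ⟨h1, h2, h3⟩
      have h4 := h.sub_smul (hasExpansion_mul_G2_pow hN ha (s + 1)) ((kappa ^ (s + 1))⁻¹)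
      have h5 := ih (h4.of_top_eq_zero (by
        simp [smul_smul, inv_mul_cancel₀ (pow_ne_zero (s + 1) kappa_ne_zero)]))
      have h6 := Submodule.add_mem _ h5 (Submodule.smul_mem _ ((kappa ^ (s + 1))⁻¹)
        (mul_G2_pow_mem_range (i := s + 1) ⟨N, hN, ha⟩))
      simpa using h6

theorem mul_G2_pow_mem_QM {i w : ℕ} {a : ℍ → ℂ} (ha : a ∈ modularTower w) : a * G2 ^ i ∈ QM := by
  -- Depth exactly i requires the top coefficient κ^i a to be nonzero.
  by_cases h0 : a = 0
  · simp [h0]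
  obtain ⟨N, hN, ha⟩ := ha
  refine Submodule.subset_span ⟨N, w + 2 * i, i, hN, isQuasimodularForm_iff.mpr (.inr
    ⟨((isModularForm_iff hN).mp ha).1.mul (mdifferentiable_G2.pow _), _,
      hasExpansion_mul_G2_pow hN ha i, ?_⟩)⟩
  simpa [kappa_ne_zero] using h0

/-- The structure theorem of Kaneko and Zagier. -/
theorem range_polyG2 : LinearMap.range polyG2 = QM := by
  apply le_antisymm
  · rintro _ ⟨c, rfl⟩
    induction c using DirectSum.induction_on with
    | zero => simp
    | of p a =>
      have := polyG2_of p.1 p.2 a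
      erw [this]
      exact mul_G2_pow_mem_QM a.2
    | add x y hx hy =>
      rw [map_add]
      exact QM.add_mem hx hy
  · refine Submodule.span_le.mpr ?_
    rintro f ⟨N, k, s, hN, hf⟩
    rcases isQuasimodularForm_iff.mp hf with ⟨rfl, -⟩ | ⟨-, φ, h, -⟩
    · exact zero_mem _
    · exact h.mem_range hN

/-- Induction principle: every quasimodular form is a sum of terms `a G₂^i`. -/
@[elab_as_elim]
theorem QM_induction {p : (ℍ → ℂ) → Prop} (hmul : ∀ (i w : ℕ) (a : ℍ → ℂ), a ∈ modularTower w →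
      p (a * G2 ^ i)) (h0 : p 0) (hadd : ∀ f g, p f → p g → p (f + g)) {f : ℍ → ℂ}
    (hf : f ∈ QM) : p f := by
  rw [← range_polyG2] at hf
  obtain ⟨c, rfl⟩ := hf
  induction c using DirectSum.induction_on with
  | zero => simpa using h0
  | of q a =>
    have := polyG2_of q.1 q.2 a
    erw [this]
    exact hmul _ _ _ a.2
  | add x y hx hy =>
    rw [map_add]
    exact hadd _ _ hx hy

/-! ### The operators on monomials in `G₂` -/

theorem opW_mul_G2_pow {i w : ℕ} {a : ℍ → ℂ} (ha : a ∈ modularTower w) (k : ℕ) :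
    opW k (a * G2 ^ i) = (i : ℂ) • (a * G2 ^ (i + k - 2)) := by
  rw [opW, LinearMap.comp_apply, coeffs_mul_G2_pow ha, sumCoeffs_of]
  rfl

theorem G4_pow_mul_mem_modularTower {w : ℕ} {a : ℍ → ℂ} (ha : a ∈ modularTower w) (l : ℕ) :
    G4 ^ l * a ∈ modularTower (4 * l + w) :=
  mul_mem_modularTower (pow_mem_modularTower G4_mem_modularTower l) ha

/-- `T_k^l` as a linear map. -/
def linT (k l : ℕ) : (ℍ → ℂ) →ₗ[ℂ] (ℍ → ℂ) := LinearMap.mulLeft ℂ (G4 ^ l) ∘ₗ opW k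

theorem linT_apply (k l : ℕ) (f : ℍ → ℂ) : linT k l f = opT k l f := rfl

theorem linT_mul_G2_pow {i w : ℕ} {a : ℍ → ℂ} (ha : a ∈ modularTower w) (k l : ℕ) :
    linT k l (a * G2 ^ i) = (i : ℂ) • (G4 ^ l * a * G2 ^ (i + k - 2)) := by
  rw [linT_apply, opT, opW_mul_G2_pow ha, mul_smul_comm, mul_assoc]

theorem dslash_mul_G2_pow {i w : ℕ} {a : ℍ → ℂ} (ha : a ∈ modularTower w) (α : GQ) :
    dslash α (a * G2 ^ i) = slash w α a * G2 ^ i := by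
  rw [dslash, LinearMap.comp_apply, coeffs_mul_G2_pow ha, sumCoeffs_of]
  rfl

theorem linT_mem_QM (k l : ℕ) {f : ℍ → ℂ} (hf : f ∈ QM) : linT k l f ∈ QM := by
  refine QM_induction (fun i w a ha => ?_) ?_ (fun f g h1 h2 => ?_) hf
  · rw [linT_mul_G2_pow ha]
    exact QM.smul_mem _ (mul_G2_pow_mem_QM (G4_pow_mul_mem_modularTower ha l))
  · rw [map_zero]
    exact QM.zero_mem
  · rw [map_add]
    exact QM.add_mem h1 h2

theorem dslash_mem_QM (α : GQ) {f : ℍ → ℂ} (hf : f ∈ QM) : dslash α f ∈ QM := by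
  refine QM_induction (fun i w a ha => ?_) ?_ (fun f g h1 h2 => ?_) hf
  · rw [dslash_mul_G2_pow ha]
    exact mul_G2_pow_mem_QM (slash_mem_modularTower α ha)
  · rw [map_zero]
    exact QM.zero_mem
  · rw [map_add]
    exact QM.add_mem h1 h2

theorem mul_mem_QM {v : ℕ} {b : ℍ → ℂ} (hb : b ∈ modularTower v) {f : ℍ → ℂ} (hf : f ∈ QM) :
    b * f ∈ QM := by
  refine QM_induction (fun i w a ha => ?_) ?_ (fun f g h1 h2 => ?_) hf
  · rw [← mul_assoc]
    exact mul_G2_pow_mem_QM (mul_mem_modularTower hb ha)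
  · rw [mul_zero]
    exact QM.zero_mem
  · rw [mul_add]
    exact QM.add_mem h1 h2

/-- Ramanujan's identity turns -G₂'/(8πi) into G₂²/2 - (5/24)G₄. -/
theorem opD_eq {f : ℍ → ℂ} (hf : f ∈ QM) :
    opD f = (1 / 2 : ℂ) • linT 3 0 f - (5 / 24 : ℂ) • linT 1 1 f := by
  refine QM_induction (fun i w a ha => ?_) ?_ (fun f g h1 h2 => ?_) hf
  · rw [opD, LinearMap.smul_apply, LinearMap.comp_apply, coeffs_mul_G2_pow ha, sumCoeffs_of,
      linT_mul_G2_pow ha, linT_mul_G2_pow ha]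
    ext z
    have hπ := Complex.two_pi_I_ne_zero
    rcases i with _ | i
    · simp
    simp only [LinearMap.smul_apply, LinearMap.mulRight_apply, Pi.smul_apply, Pi.mul_apply,
      Pi.pow_apply, Pi.sub_apply, smul_eq_mul, G2'_eq, Nat.add_sub_cancel,
      show i + 1 + 3 - 2 = i + 2 by omega, show i + 1 + 1 - 2 = i by omega]
    rw [show (8 * (Real.pi : ℂ) * Complex.I) = 4 * (2 * (Real.pi : ℂ) * Complex.I) by ring]
    field_simp
    ring
  · simp
  · rw [map_add, map_add, map_add, h1, h2, smul_add, smul_add]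
    abel

theorem opD_mem_QM {f : ℍ → ℂ} (hf : f ∈ QM) : opD f ∈ QM := by
  rw [opD_eq hf]
  exact QM.sub_mem (QM.smul_mem _ (linT_mem_QM _ _ hf)) (QM.smul_mem _ (linT_mem_QM _ _ hf))

/-! ### Commutation relations -/

theorem linT_comm {k k' : ℕ} (hk : 1 ≤ k) (hk' : 1 ≤ k') (l l' : ℕ) {f : ℍ → ℂ} (hf : f ∈ QM) :
    linT k l (linT k' l' f) - linT k' l' (linT k l f) =
      ((k' : ℂ) - (k : ℂ)) • linT (k + k' - 2) (l + l') f := by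
  obtain ⟨k, rfl⟩ := Nat.exists_eq_add_of_le' hk
  obtain ⟨k', rfl⟩ := Nat.exists_eq_add_of_le' hk'
  refine QM_induction (fun i w a ha => ?_) ?_ (fun f g h1 h2 => ?_) hf
  · rw [linT_mul_G2_pow ha, linT_mul_G2_pow ha, map_smul, map_smul,
      linT_mul_G2_pow (G4_pow_mul_mem_modularTower ha _),
      linT_mul_G2_pow (G4_pow_mul_mem_modularTower ha _), linT_mul_G2_pow ha]
    -- For i = 0 the factor i kills every term, so truncated exponents do no harm; otherwise all
    -- three terms carry the same power of `G2`.
    rcases i with _ | i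
    · simp
    rw [show i + 1 + (k' + 1) - 2 = i + k' by omega, show i + 1 + (k + 1) - 2 = i + k by omega,
      show k + 1 + (k' + 1) - 2 = k + k' by omega,
      show i + k' + (k + 1) - 2 = i + 1 + (k + k') - 2 by omega,
      show i + k + (k' + 1) - 2 = i + 1 + (k + k') - 2 by omega]
    ext z
    simp only [Pi.smul_apply, Pi.mul_apply, Pi.pow_apply, Pi.sub_apply, smul_eq_mul]
    push_cast
    ring
  · simp
  · simp only [map_add, smul_add, ← h1, ← h2]
    abel

/-- By `opD_eq` this combines the brackets of T_k^l with T_3^0 and T_1^1. -/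
theorem linT_opD_comm {k : ℕ} (hk : 1 ≤ k) (l : ℕ) {f : ℍ → ℂ} (hf : f ∈ QM) :
    linT k l (opD f) - opD (linT k l f) =
      ((5 / 24 : ℂ) * ((k : ℂ) - 1)) • linT (k - 1) (l + 1) f -
        ((1 / 2 : ℂ) * ((k : ℂ) - 3)) • linT (k + 1) l f := by
  have h1 := linT_comm hk (by norm_num : 1 ≤ 3) l 0 hf
  have h2 := linT_comm hk le_rfl l 1 hf
  rw [show k + 3 - 2 = k + 1 by omega, add_zero] at h1
  rw [show k + 1 - 2 = k - 1 by omega] at h2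
  rw [opD_eq hf, opD_eq (linT_mem_QM k l hf)]
  ext z
  have h1 := congrFun h1 z
  have h2 := congrFun h2 z
  simp only [map_sub, map_smul, Pi.smul_apply, Pi.sub_apply, smul_eq_mul] at h1 h2 ⊢
  push_cast at h1 h2
  linear_combination (1 / 2) * h1 - (5 / 24) * h2

theorem linT_mul (k l : ℕ) {v : ℕ} {b : ℍ → ℂ} (hb : b ∈ modularTower v) {f : ℍ → ℂ}
    (hf : f ∈ QM) : linT k l (b * f) = b * linT k l f := by
  refine QM_induction (fun i w a ha => ?_) ?_ (fun f g h1 h2 => ?_) hf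
  · rw [← mul_assoc, linT_mul_G2_pow (mul_mem_modularTower hb ha), linT_mul_G2_pow ha,
      mul_smul_comm]
    congr 1
    ring
  · simp
  · rw [mul_add, map_add, map_add, mul_add, h1, h2]

theorem opD_mul {v : ℕ} {b : ℍ → ℂ} (hb : b ∈ modularTower v) {f : ℍ → ℂ} (hf : f ∈ QM) :
    opD (b * f) = b * opD f := by
  rw [opD_eq hf, opD_eq (mul_mem_QM hb hf), linT_mul _ _ hb hf, linT_mul _ _ hb hf, mul_sub,
    mul_smul_comm, mul_smul_comm]

/-- The operation ‖γ acts on modular coefficients and T on powers of `G2`; they interact only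
through G₄^l, which SL₂(ℤ) fixes. -/
theorem dslash_linT (k l : ℕ) (γ : SL(2, ℤ)) {f : ℍ → ℂ} (hf : f ∈ QM) :
    dslash (toGQ γ) (linT k l f) = linT k l (dslash (toGQ γ) f) := by
  refine QM_induction (fun i w a ha => ?_) ?_ (fun f g h1 h2 => ?_) hf
  · rw [linT_mul_G2_pow ha, map_smul, dslash_mul_G2_pow (G4_pow_mul_mem_modularTower ha l),
      dslash_mul_G2_pow ha, linT_mul_G2_pow (slash_mem_modularTower _ ha), slash_mul, G4_pow_slash]
  · simp
  · simp only [map_add, h1, h2]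

theorem dslash_opD (γ : SL(2, ℤ)) {f : ℍ → ℂ} (hf : f ∈ QM) :
    dslash (toGQ γ) (opD f) = opD (dslash (toGQ γ) f) := by
  rw [opD_eq hf, opD_eq (dslash_mem_QM _ hf), map_sub, map_smul, map_smul, dslash_linT _ _ _ hf,
    dslash_linT _ _ _ hf]

theorem dslash_mul {v : ℕ} {b : ℍ → ℂ} (hb : b ∈ modularTower v) (α : GQ) {f : ℍ → ℂ}
    (hf : f ∈ QM) : dslash α (b * f) = slash v α b * dslash α f := by
  refine QM_induction (fun i w a ha => ?_) ?_ (fun f g h1 h2 => ?_) hf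
  · rw [← mul_assoc, dslash_mul_G2_pow (mul_mem_modularTower hb ha), dslash_mul_G2_pow ha,
      slash_mul, mul_assoc]
  · simp
  · rw [mul_add, map_add, map_add, mul_add, h1, h2]

/-! ### The action on quasimodular Hecke operators -/

/-- The operator on functions `GL₂⁺(ℚ) → (ℍ → ℂ)` attached to a symbol, in the component `α`. -/
def symbolOp : Symbols → GQ → (ℍ → ℂ) →ₗ[ℂ] (ℍ → ℂ)
  | .D, _ => opD
  | .T k l, _ => linT k l
  | .phi m, α => LinearMap.mulLeft ℂ (nu m α)

theorem symbolOp_mem_QM (x : Symbols) (α : GQ) {f : ℍ → ℂ} (hf : f ∈ QM) :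
    symbolOp x α f ∈ QM :=
  match x with
  | .D => opD_mem_QM hf
  | .T k l => linT_mem_QM k l hf
  | .phi m => mul_mem_QM (nu_mem_modularTower m α) hf

theorem symbolOp_mul_left (x : Symbols) (γ : SL(2, ℤ)) (α : GQ) :
    symbolOp x (toGQ γ * α) = symbolOp x α :=
  match x with
  | .D => rfl
  | .T _ _ => rfl
  | .phi m => congrArg (LinearMap.mulLeft ℂ) (nu_mul_left m γ α)

theorem dslash_symbolOp (x : Symbols) (γ : SL(2, ℤ)) (α : GQ) {f : ℍ → ℂ} (hf : f ∈ QM) :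
    dslash (toGQ γ) (symbolOp x α f) = symbolOp x (α * toGQ γ) (dslash (toGQ γ) f) :=
  match x with
  | .D => dslash_opD γ hf
  | .T k l => dslash_linT k l γ hf
  | .phi m => by
    simp only [symbolOp, LinearMap.mulLeft_apply]
    rw [dslash_mul (nu_mem_modularTower m α) _ hf, nu_mul_right]

/-- The endomorphism of `Q(Γ(N))` attached to a symbol. -/
def symbolEnd (N : ℕ) (x : Symbols) : Module.End ℂ (HeckeOps N) where
  toFun F := ⟨fun α => symbolOp x α (F.1 α), by
    obtain ⟨F, h1, h2, h3, h4⟩ := F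
    refine ⟨fun α => symbolOp_mem_QM x α (h1 α), ?_, ?_, ?_⟩
    · rintro _ ⟨γ, hγ, rfl⟩ α
      change symbolOp x (toGQ γ * α) (F (toGQ γ * α)) = symbolOp x α (F α)
      rw [symbolOp_mul_left, h2 _ ⟨γ, hγ, rfl⟩]
    -- The operators act linearly in each component, so supports can only shrink.
    · refine h3.subset (Set.image_mono fun α hα h0 => hα ?_)
      change symbolOp x α (F α) = 0
      rw [h0, map_zero]
    · rintro _ ⟨γ, hγ, rfl⟩ α
      change symbolOp x (α * toGQ γ) (F (α * toGQ γ)) = dslash (toGQ γ) (symbolOp x α (F α))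
      rw [dslash_symbolOp x γ α (h1 α), h4 _ ⟨γ, hγ, rfl⟩]⟩
  map_add' F G := by
    ext α : 2
    exact map_add (symbolOp x α) _ _
  map_smul' c F := by
    ext α : 2
    exact map_smul (symbolOp x α) _ _

/-- The action of the free Lie algebra. -/
def freeAction (N : ℕ) : FreeL →ₗ⁅ℂ⁆ Module.End ℂ (HeckeOps N) :=
  FreeLieAlgebra.lift ℂ (symbolEnd N)

theorem freeAction_freeT (N : ℕ) {k : ℕ} (hk : 0 < k) (l : ℕ) :
    freeAction N (freeT k l) = symbolEnd N (.T ⟨k, hk⟩ l) := by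
  rw [freeT, dif_pos hk, freeAction, FreeLieAlgebra.lift_of_apply]

theorem freeAction_freeD (N : ℕ) : freeAction N freeD = symbolEnd N .D := by
  rw [freeD, freeAction, FreeLieAlgebra.lift_of_apply]

theorem freeAction_freePhi (N : ℕ) (m : ℕ+) : freeAction N (freePhi m) = symbolEnd N (.phi m) := by
  rw [freePhi, freeAction, FreeLieAlgebra.lift_of_apply]

theorem symbolEnd_lie_apply (N : ℕ) (x y : Symbols) (F : HeckeOps N) (α : GQ) :
    (⁅symbolEnd N x, symbolEnd N y⁆ F).1 α =
      symbolOp x α (symbolOp y α (F.1 α)) - symbolOp y α (symbolOp x α (F.1 α)) := rfl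

/-- Scalar multiples of `T_k^l` in the action, where the coefficient of `T_0^l` vanishes. -/
theorem smul_freeAction_freeT_apply (N : ℕ) (k l : ℕ) (c : ℂ) (hc : k = 0 → c = 0)
    (F : HeckeOps N) (α : GQ) :
    ((c • freeAction N (freeT k l)) F).1 α = c • linT k l (F.1 α) := by
  rcases Nat.eq_zero_or_pos k with rfl | hk
  · rw [hc rfl, zero_smul, zero_smul]
    rfl
  · rw [freeAction_freeT N hk]
    rfl

theorem freeAction_relator (N : ℕ) {x : FreeL} (hx : IsRelator x) : freeAction N x = 0 := by
  refine LinearMap.ext fun F => Subtype.ext (funext fun α => ?_)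
  have hF : F.1 α ∈ QM := F.2.1 α
  cases hx with
  | TT k k' l l' hk hk' =>
    rw [map_sub, LieHom.map_lie, map_smul]
    change (⁅freeAction N (freeT k l), freeAction N (freeT k' l')⁆ F).1 α -
      (((k' : ℂ) - (k : ℂ)) • freeAction N (freeT (k + k' - 2) (l + l')) <| F).1 α = 0
    rw [smul_freeAction_freeT_apply, freeAction_freeT N hk, freeAction_freeT N hk',
      symbolEnd_lie_apply, sub_eq_zero]
    · exact linT_comm hk hk' l l' hF
    -- Index 0 forces k = k' = 1 and hence coefficient 0; this matters because `freeT 0` is zero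
    -- while `linT 0` is not.
    · intro h0
      rw [show k = k' by omega, sub_self]
  | Dphi m =>
    rw [LieHom.map_lie, freeAction_freeD, freeAction_freePhi, symbolEnd_lie_apply]
    exact sub_eq_zero.mpr (opD_mul (nu_mem_modularTower m α) hF)
  | Tphi k l m hk =>
    rw [LieHom.map_lie, freeAction_freeT N hk, freeAction_freePhi, symbolEnd_lie_apply]
    exact sub_eq_zero.mpr (linT_mul k l (nu_mem_modularTower m α) hF)
  | phiphi m m' =>
    rw [LieHom.map_lie, freeAction_freePhi, freeAction_freePhi, symbolEnd_lie_apply]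
    exact sub_eq_zero.mpr (mul_left_comm _ _ _)
  | TD k l hk =>
    rw [map_sub, map_sub, LieHom.map_lie, map_smul, map_smul]
    change (⁅freeAction N (freeT k l), freeAction N freeD⁆ F).1 α -
      ((((5 / 24 : ℂ) * ((k : ℂ) - 1)) • freeAction N (freeT (k - 1) (l + 1)) <| F).1 α -
        (((1 / 2 : ℂ) * ((k : ℂ) - 3)) • freeAction N (freeT (k + 1) l) <| F).1 α) = 0
    rw [smul_freeAction_freeT_apply, smul_freeAction_freeT_apply, freeAction_freeT N hk,
      freeAction_freeD, symbolEnd_lie_apply, sub_eq_zero]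
    · exact linT_opD_comm hk l hF
    · omega
    · intro h0
      rw [show k = 1 by omega]
      simp

theorem relIdeal_le_ker (N : ℕ) : relIdeal ≤ (freeAction N).ker :=
  LieSubmodule.lieSpan_le.mpr fun _ hx => LieHom.mem_ker.mpr (freeAction_relator N hx)

/-- The action of the Lie algebra `L`. -/
def action (N : ℕ) : LieL →ₗ⁅ℂ⁆ Module.End ℂ (HeckeOps N) where
  toLinearMap := relIdeal.toSubmodule.liftQ (freeAction N : FreeL →ₗ[ℂ] _)
    fun _ hx => LinearMap.mem_ker.mpr (LieHom.mem_ker.mp (relIdeal_le_ker N hx))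
  map_lie' {x y} := by
    obtain ⟨x, rfl⟩ := LieSubmodule.Quotient.surjective_mk' relIdeal x
    obtain ⟨y, rfl⟩ := LieSubmodule.Quotient.surjective_mk' relIdeal y
    exact LieHom.map_lie (freeAction N) x y

theorem action_gen (N : ℕ) (x : Symbols) : action N (gen x) = symbolEnd N x :=
  FreeLieAlgebra.lift_of_apply (R := ℂ) (symbolEnd N) x

end

end QuasimodularHecke

theorem mainTheorem12 (N : ℕ) (hN : 1 ≤ N) :
    ∃ ρ : QuasimodularHecke.LieL →ₗ⁅ℂ⁆ Module.End ℂ (QuasimodularHecke.HeckeOps N),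
      (∀ (F : QuasimodularHecke.HeckeOps N) (α : QuasimodularHecke.GQ),
        (ρ (QuasimodularHecke.gen QuasimodularHecke.Symbols.D) F).1 α =
          QuasimodularHecke.opD (F.1 α)) ∧
      (∀ (k : ℕ+) (l : ℕ) (F : QuasimodularHecke.HeckeOps N) (α : QuasimodularHecke.GQ),
        (ρ (QuasimodularHecke.gen (QuasimodularHecke.Symbols.T k l)) F).1 α =
          QuasimodularHecke.opT k l (F.1 α)) ∧
      (∀ (m : ℕ+) (F : QuasimodularHecke.HeckeOps N) (α : QuasimodularHecke.GQ),
        (ρ (QuasimodularHecke.gen (QuasimodularHecke.Symbols.phi m)) F).1 α =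
          QuasimodularHecke.nu m α * F.1 α) := by
  refine ⟨QuasimodularHecke.action N, fun F α => ?_, fun k l F α => ?_, fun m F α => ?_⟩
  all_goals
    rw [QuasimodularHecke.action_gen]
    rfl
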